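/- Let $q\ge 1$ be an integer, $\mathbb{Z}_q=\mathbb{Z}/q\mathbb{Z}$, let $\alpha,\beta$ be non-zero real numbers, and let $r,t\in\{0,\dots,q-1\}$ be integers coprime to $q$ (so $r=t=0$ if $q=1$). Equip $\mathbb{R}\times\mathbb{Z}_q$ with the product of Lebesgue and counting measure, and let $\langle f,g\rangle=\int f\,\overline{g}$ be the inner product of $L^2(\mathbb{R}\times\mathbb{Z}_q)$. For $\nu=(\lambda,l,\gamma,c)\in\mathbb{R}\times\mathbb{Z}_q\times\mathbb{R}\times\mathbb{Z}_q$ put $$\pi(\nu)f(x,j)=e^{2\pi i(x\gamma+jc/q)}f(x-\lambda,j-l),\qquad \varphi(\nu_1,\nu_2)=e^{-2\pi i(\lambda_1\gamma_2+l_1c_2/q)},$$ and let $$\Lambda=\{(\alpha n,rn \bmod q):n\in\mathbb{Z}\},\qquad \Gamma=\{(\beta m,tm \bmod q):m\in\mathbb{Z}\}.$$ Fix a non-zero Schwartz function $\phi$ on $\mathbb{R}$. For $s\ge 0$, $M^1_s(\mathbb{R})$ is the space of all $f\in L^2(\mathbb{R})$ with $$\int_{\mathbb{R}^2}\Big|\int_{\mathbb{R}}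 f(y)\,e^{-2\pi i y\omega}\,\overline{\phi(y-x)}\,dy\Big|\,(1+|x|+|\omega|)^s\,d(x,\omega)<\infty,$$ and $M^1_s(\mathbb{R}\times\mathbb{Z}_q)$ is the space of all $f\in L^2(\mathbb{R}\times\mathbb{Z}_q)$ with $f(\cdot,k)\in M^1_s(\mathbb{R})$ for all $k\in\mathbb{Z}_q$. Let $\ell^1_s(\Lambda\times\Gamma)$ be the space of all $a:\Lambda\times\Gamma\to\mathbb{C}$ with $\sum_{(\lambda,l,\gamma,c)}|a(\lambda,l,\gamma,c)|(1+|\lambda|+|\gamma|)^s<\infty$. On sequences indexed by $\Lambda\times\Gamma$ consider the twisted convolution $(a\,\natural\,b)(\nu)=\sum_{\nu'\in\Lambda\times\Gamma}a(\nu')\,b(\nu-\nu')\,\varphi(\nu',\nu-\nu')$, the derivations $(\partial_1a)(\lambda,l,\gamma,c)=2\pi i\lambda\,a(\lambda,l,\gamma,c)$ and $(\partial_2a)(\lambda,l,\gamma,c)=2\pi i\gamma\,a(\lambda,l,\gamma,c)$, and the trace $\mathrm{tr}(a)=a(0)$. Let $s\ge 1$ and let $g,h\in M^1_s(\mathbb{R}\times\mathbb{Z}_q)$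 generate dual Gabor frames, that is, $\{\pi(\nu)g\}_{\nu\in\Lambda\times\Gamma}$ and $\{\pi(\nu)h\}_{\nu\in\Lambda\times\Gamma}$ are frames for $L^2(\mathbb{R}\times\mathbb{Z}_q)$ and $$f=\sum_{\nu\in\Lambda\times\Gamma}\langle f,\pi(\nu)g\rangle\,\pi(\nu)h\qquad\text{for all } f\in M^1_s(\mathbb{R}\times\mathbb{Z}_q),$$ with unconditional convergence in $L^2(\mathbb{R}\times\mathbb{Z}_q)$. Let $p=(\langle g,\pi(\nu)h\rangle)_{\nu\in\Lambda\times\Gamma}$. Then $p\in\ell^1_s(\Lambda\times\Gamma)$, $p\,\natural\,p=p$, and the Connes–Chern number of $p$ is $$c_1(p)=\frac{1}{2\pi i\,|\alpha\beta|}\,\mathrm{tr}\Big(p\,\natural\,\big[(\partial_1p)\,\natural\,(\partial_2p)-(\partial_2p)\,\natural\,(\partial_1p)\big]\Big)=q.$$ -/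

import Mathlib

open MeasureTheory Filter Topology
open scoped SchwartzMap ComplexConjugate

noncomputable section

namespace GaborTorus

/-- `L²`-inner product `⟨f, g⟩ = ∫ f · conj g dμ`, linear in the first entry. -/
def l2inner {X : Type*} [MeasurableSpace X] (μ : Measure X) (f g : X → ℂ) : ℂ :=
  ∫ x, f x * conj (g x) ∂μ

/-! ### The weighted modulation spaces -/

/-- `(E_ω T_x φ)(t) = e^{2πitω} φ(t - x)` on the real line. -/
def tfShiftReal (x ω : ℝ) (φ : ℝ → ℂ) : ℝ → ℂ :=
  fun t => Complex.exp (2 * Real.pi * Complex.I * (t * ω)) * φ (t - x)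

/-- `f ∈ M¹_s(ℝ)`, where the space is computed with the Schwartz window `φ`. -/
def MemM1Real (φ : 𝓢(ℝ, ℂ)) (s : ℝ) (f : ℝ → ℂ) : Prop :=
  MemLp f 2 volume ∧
    Integrable (fun z : ℝ × ℝ =>
      ‖l2inner volume f (tfShiftReal z.1 z.2 φ)‖ * (1 + |z.1| + |z.2|) ^ s) volume

/-- The time domain `ℝ × ℤ_q`; as a group, the frequency domain is `ℝ × ℤ_q` too. -/
abbrev TimeDomain (q : ℕ) : Type := ℝ × ZMod q

/-- The measure of the time domain: Lebesgue measure times counting measure. -/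
def timeMeasure (q : ℕ) : Measure (TimeDomain q) :=
  (volume : Measure ℝ).prod Measure.count

/-- `f ∈ L²(ℝ × ℤ_q)`. -/
def MemL2 {q : ℕ} (f : TimeDomain q → ℂ) : Prop := MemLp f 2 (timeMeasure q)

/-- `f ∈ M¹_s(ℝ × ℤ_q)`, computed with the Schwartz window `φ`. -/
def MemM1 {q : ℕ} (φ : 𝓢(ℝ, ℂ)) (s : ℝ) (f : TimeDomain q → ℂ) : Prop :=
  MemL2 f ∧ ∀ k : ZMod q, MemM1Real φ s (fun x => f (x, k))

/-! ### Time-frequency shifts, the cocycle and the lattice -/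

/-- The phase space; a point is `ν = ((λ, l), (γ, c))`. -/
abbrev Phase (q : ℕ) : Type := TimeDomain q × TimeDomain q

section Shifts

variable {q : ℕ} [NeZero q]

/-- `π(ν) f (x, j) = e^{2πi(xγ + jc/q)} f(x - λ, j - l)`; here `ZMod.stdAddChar` is
`j ↦ e^{2πij/q}`. -/
def tfShift (ν : Phase q) (f : TimeDomain q → ℂ) : TimeDomain q → ℂ :=
  fun z => Complex.exp (2 * Real.pi * Complex.I * (z.1 * ν.2.1)) *
    ZMod.stdAddChar (z.2 * ν.2.2) * f (z.1 - ν.1.1, z.2 - ν.1.2)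

/-- The `2`-cocycle `e^{-2πi(λ₁γ₂ + l₁c₂/q)}`, for which
`π(ν₁)π(ν₂) = cocycle ν₁ ν₂ · π(ν₁ + ν₂)`. -/
def cocycle (ν₁ ν₂ : Phase q) : ℂ :=
  Complex.exp (-(2 * Real.pi * Complex.I * (ν₁.1.1 * ν₂.2.1))) *
    ZMod.stdAddChar (-(ν₁.1.2 * ν₂.2.2))

end Shifts

/-- The lattice `{(a n, m n mod q) : n ∈ ℤ}` in `ℝ × ℤ_q`. -/
def lineLattice (q : ℕ) (a : ℝ) (m : ℕ) : AddSubgroup (TimeDomain q) :=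
  AddSubgroup.zmultiples (a, (m : ZMod q))

/-- The lattice `Λ × Γ` with `Λ = {(αn, rn mod q)}` and `Γ = {(βm, tm mod q)}`. -/
def lattice (q : ℕ) (α β : ℝ) (r t : ℕ) : AddSubgroup (Phase q) :=
  (lineLattice q α r).prod (lineLattice q β t)

/-! ### Sequences on a lattice: weighted `ℓ¹`, twisted convolution, derivations, trace -/

section Sequences

variable {q : ℕ} {L : AddSubgroup (Phase q)}

/-- `a ∈ ℓ¹_s(L)`. -/
def MemEll1 (s : ℝ) (a : L → ℂ) : Prop :=
  (Summable fun ν : L => ‖a ν‖) ∧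
    Summable fun ν : L => ‖a ν‖ * (1 + |ν.1.1.1| + |ν.1.2.1|) ^ s

/-- The twisted convolution
`(a ♮ b)(ν) = ∑_{ν'} a(ν') b(ν - ν') cocycle(ν', ν - ν')`. -/
def twistedConv [NeZero q] (a b : L → ℂ) : L → ℂ :=
  fun ν => ∑' ν' : L, a ν' * b (ν - ν') * cocycle (ν' : Phase q) ((ν - ν' : L) : Phase q)

/-- `(∂₁ a)(λ, l, γ, c) = 2πiλ a(λ, l, γ, c)`. -/
def deriv1 (a : L → ℂ) : L → ℂ :=
  fun ν => 2 * Real.pi * Complex.I * (ν.1.1.1 : ℂ) * a ν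

/-- `(∂₂ a)(λ, l, γ, c) = 2πiγ a(λ, l, γ, c)`. -/
def deriv2 (a : L → ℂ) : L → ℂ :=
  fun ν => 2 * Real.pi * Complex.I * (ν.1.2.1 : ℂ) * a ν

/-- The trace `tr(a) = a(0)`. -/
def trace (a : L → ℂ) : ℂ := a 0

end Sequences

section Frames

variable {q : ℕ} [NeZero q]

/-- The sequence valued inner product `⟨f, g⟩ = (⟨f, π(ν) g⟩)_{ν ∈ L}`. -/
def latticeInner (L : AddSubgroup (Phase q)) (f g : TimeDomain q → ℂ) : L → ℂ :=
  fun ν => l2inner (timeMeasure q) f (tfShift (ν : Phase q) g)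

/-- `{π(ν) g}_{ν ∈ L}` is a frame for `L²(ℝ × ℤ_q)`. -/
def IsGaborFrame (L : AddSubgroup (Phase q)) (g : TimeDomain q → ℂ) : Prop :=
  ∃ A B : ℝ, 0 < A ∧ 0 < B ∧ ∀ f : TimeDomain q → ℂ, MemL2 f →
    (Summable fun ν : L => ‖latticeInner L f g ν‖ ^ 2) ∧
    A * ∫ z, ‖f z‖ ^ 2 ∂(timeMeasure q) ≤ ∑' ν : L, ‖latticeInner L f g ν‖ ^ 2 ∧
    ∑' ν : L, ‖latticeInner L f g ν‖ ^ 2 ≤ B * ∫ z, ‖f z‖ ^ 2 ∂(timeMeasure q)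

/-- `f = ∑_{ν ∈ L} ⟨f, π(ν) g⟩ π(ν) h`, with unconditional convergence in `L²(ℝ × ℤ_q)`. -/
def HasGaborExpansion (L : AddSubgroup (Phase q)) (f g h : TimeDomain q → ℂ) : Prop :=
  Tendsto (fun F : Finset L =>
      eLpNorm (fun z => f z - ∑ ν ∈ F, latticeInner L f g ν * tfShift (ν : Phase q) h z) 2
        (timeMeasure q))
    atTop (𝓝 0)

/-- `{π(ν) g}` and `{π(ν) h}` are dual Gabor frames: both are frames for `L²(ℝ × ℤ_q)`, and
`f = ∑_ν ⟨f, π(ν) g⟩ π(ν) h` for all `f ∈ M¹_s(ℝ × ℤ_q)`. -/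
def AreDualGaborFrames (φ : 𝓢(ℝ, ℂ)) (s : ℝ) (L : AddSubgroup (Phase q))
    (g h : TimeDomain q → ℂ) : Prop :=
  IsGaborFrame L g ∧ IsGaborFrame L h ∧
    ∀ f : TimeDomain q → ℂ, MemM1 φ s f → HasGaborExpansion L f g h

/-- The Connes–Chern number
`c₁(p) = (2πi|αβ|)⁻¹ tr(p ♮ [(∂₁p) ♮ (∂₂p) - (∂₂p) ♮ (∂₁p)])` over `Λ × Γ`. -/
def connesChern (α β : ℝ) (r t : ℕ) (p : lattice q α β r t → ℂ) : ℂ :=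
  (2 * Real.pi * Complex.I * (|α * β| : ℝ))⁻¹ *
    trace (twistedConv p
      (twistedConv (deriv1 p) (deriv2 p) - twistedConv (deriv2 p) (deriv1 p)))

end Frames

end GaborTorus

end

/-! Write `U ν` for the time-frequency shifts restricted to the lattice, so that `p ν = ⟪U ν h, g⟫`,
and let `P = ∑ p(ν) U(ν)` be the integrated operator. The proof treats `p` as the projection of a
module with a constant-curvature connection.

Duality of the frames gives `P g = g`, and convolving `p` with a coefficient sequence `⟪U ν h, f⟫`
replaces `f` by `P f`; hence `p ♮ p = p` (`IsDualPair.tconv_self`).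

The operators `2πit` and `d/dt` are skew-adjoint and commute with `U ν` up to the scalars `2πiλ` and
`2πiγ`. With `gᵢ`, `hᵢ` the images of `g`, `h`, this gives `∂ᵢp(ν) = ⟪U ν h, gᵢ⟫ + ⟪U ν hᵢ, g⟫`.
Substituting in the trace and using the frame expansion, everything symmetric in the two derivations
cancels and `⟪h₁, g₂⟫ - ⟪h₂, g₁⟫` remains (`IsDualPair.tconv_commutator`). Since `[d/dt, 2πit] =
2πi`, this equals `2πi⟪h, g⟫` (`gradGraph_curvature`).

Finally `⟪h, g⟫ = q|αβ|` (`inner_eq_covolume`). The expansion of a shifted test window says that the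
lattice translates of a product of short-time Fourier transforms add up to a constant; integrating
over a fundamental cell and applying Moyal's identity yields the covolume, and the `q` residues
yield the factor `q`.

The analytic input is the inversion formula `integral_stft_smul_tfL`. It puts `g` and `h` in the
domain of the connection when `s ≥ 1` (`exists_gradGraph`), and it bounds the lattice coefficients,
so that `p` is in weighted `ℓ¹` (`summable_inner_tfL`). -/

noncomputable section

namespace GaborTorus

/-! ### Projections and connections for an abstract projective representation -/

section Projective

open scoped InnerProductSpace

variable {L H : Type*} [AddCommGroup L] [NormedAddCommGroup H] [InnerProductSpace ℂ H]

/-- The twisted convolution of two sequences on an abelian group, for a cocycle `σ`. -/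
def tconv (σ : L → L → ℂ) (a b : L → ℂ) : L → ℂ :=
  fun ν => ∑' μ : L, a μ * b (ν - μ) * σ μ (ν - μ)

/-- A projective unitary representation of `L` with cocycle `σ`. -/
structure IsProjRep (σ : L → L → ℂ) (U : L → H →ₗᵢ[ℂ] H) : Prop where
  norm_cocycle : ∀ μ ν, ‖σ μ ν‖ = 1
  map_zero : ∀ f, U 0 f = f
  map_map : ∀ μ ν f, U μ (U ν f) = σ μ ν • U (μ + ν) f

/-- The integrated form `∑ a(ν) U(ν)` of a projective representation. -/
def opSum (U : L → H →ₗᵢ[ℂ] H) (a : L → ℂ) (f : H) : H := ∑' ν, a ν • U ν f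

variable {σ : L → L → ℂ} {U : L → H →ₗᵢ[ℂ] H}

lemma IsProjRep.conj_mul_cocycle (hU : IsProjRep σ U) (μ ν : L) : conj (σ μ ν) * σ μ ν = 1 := by
  rw [Complex.conj_mul', hU.norm_cocycle]; simp

lemma IsProjRep.map_map_neg (hU : IsProjRep σ U) (ν : L) (f : H) :
    U ν (U (-ν) f) = σ ν (-ν) • f := by
  rw [hU.map_map, add_neg_cancel, hU.map_zero]

lemma IsProjRep.inner_left (hU : IsProjRep σ U) (ν : L) (a b : H) :
    ⟪U ν a, b⟫_ℂ = conj (σ ν (-ν)) * ⟪a, U (-ν) b⟫_ℂ := by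
  have h : b = conj (σ ν (-ν)) • U ν (U (-ν) b) := by
    rw [hU.map_map_neg, smul_smul, hU.conj_mul_cocycle, one_smul]
  conv_lhs => rw [h]
  rw [inner_smul_right, LinearIsometry.inner_map_map]

lemma IsProjRep.inner_right (hU : IsProjRep σ U) (ν : L) (a b : H) :
    ⟪a, U ν b⟫_ℂ = σ ν (-ν) * ⟪U (-ν) a, b⟫_ℂ := by
  rw [← inner_conj_symm, hU.inner_left, map_mul, Complex.conj_conj, inner_conj_symm]

/-- The phases `σ ν (-ν)` and its conjugate, produced by moving `U ν` across each factor, cancel.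
The substitution `ν ↦ -ν` thus exchanges windows in a frame sum without leaving a cocycle. -/
lemma IsProjRep.reflect (hU : IsProjRep σ U) (ν : L) (a b c d : H) :
    ⟪U ν a, b⟫_ℂ * ⟪c, U ν d⟫_ℂ = ⟪U (-ν) c, d⟫_ℂ * ⟪a, U (-ν) b⟫_ℂ := by
  rw [hU.inner_left ν a b, hU.inner_right ν c d]
  linear_combination (⟪a, U (-ν) b⟫_ℂ * ⟪U (-ν) c, d⟫_ℂ) * hU.conj_mul_cocycle ν (-ν)

/-- The cocycle in a twisted convolution is exactly what turns a coefficient at `ν - μ` into one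
between two shifted vectors. -/
lemma IsProjRep.inner_map_sub (hU : IsProjRep σ U) (μ ν : L) (a b : H) :
    ⟪U (ν - μ) b, a⟫_ℂ * σ μ (ν - μ) = ⟪U ν b, U μ a⟫_ℂ := by
  have h : U ν b = conj (σ μ (ν - μ)) • U μ (U (ν - μ) b) := by
    rw [hU.map_map, smul_smul, hU.conj_mul_cocycle, one_smul, add_sub_cancel]
  rw [h, inner_smul_left, LinearIsometry.inner_map_map, Complex.conj_conj, mul_comm]

lemma summable_norm_tconv (hσ : ∀ μ ν, ‖σ μ ν‖ = 1) {a b : L → ℂ}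
    (ha : Summable fun ν => ‖a ν‖) (hb : Summable fun ν => ‖b ν‖) :
    Summable fun z : L × L => ‖a z.1 * b (z.2 - z.1) * σ z.1 (z.2 - z.1)‖ := by
  have h := (summable_mul_of_summable_norm ha hb).norm
  let e : L × L ≃ L × L :=
    ⟨fun z => (z.1, z.2 - z.1), fun z => (z.1, z.1 + z.2), fun z => by simp, fun z => by simp⟩
  have h2 := e.summable_iff.2 h
  refine h2.congr fun z => ?_
  simp [e, hσ]

lemma summable_tconv (hσ : ∀ μ ν, ‖σ μ ν‖ = 1) {a b : L → ℂ}
    (ha : Summable fun ν => ‖a ν‖) (hb : Summable fun ν => ‖b ν‖) (ν : L) :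
    Summable fun μ => a μ * b (ν - μ) * σ μ (ν - μ) := by
  have h : Summable fun z : L × L => a z.2 * b (z.1 - z.2) * σ z.2 (z.1 - z.2) :=
    (Equiv.prodComm L L).summable_iff.2 (Summable.of_norm (summable_norm_tconv hσ ha hb))
  exact h.prod_factor ν

lemma tconv_leibniz (hσ : ∀ μ ν, ‖σ μ ν‖ = 1) {p : L → ℂ} (θ : L →+ ℂ)
    (hp : Summable fun ν => ‖p ν‖) (hθ : Summable fun ν => ‖θ ν * p ν‖) (ν : L) :
    θ ν * tconv σ p p ν =
      tconv σ (fun ν => θ ν * p ν) p ν + tconv σ p (fun ν => θ ν * p ν) ν := by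
  simp only [tconv]
  rw [← (summable_tconv hσ hθ hp ν).tsum_add (summable_tconv hσ hp hθ ν), ← tsum_mul_left]
  refine tsum_congr fun μ => ?_
  rw [map_sub]
  ring

section Complete

variable [CompleteSpace H]

lemma hasSum_opSum {a : L → ℂ} (ha : Summable fun ν => ‖a ν‖) (f : H) :
    HasSum (fun ν => a ν • U ν f) (opSum U a f) := by
  refine Summable.hasSum (Summable.of_norm ?_)
  simpa [norm_smul] using ha.mul_right ‖f‖

lemma hasSum_inner_opSum {a : L → ℂ} (ha : Summable fun ν => ‖a ν‖) (v f : H) :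
    HasSum (fun ν => a ν * ⟪v, U ν f⟫_ℂ) ⟪v, opSum U a f⟫_ℂ := by
  simpa [inner_smul_right] using (hasSum_opSum (U := U) ha f).mapL (innerSL ℂ v)

/-- The main computational rule: convolving a coefficient sequence on the left by `a` applies `opSum
U a` to its right-hand vector. -/
lemma IsProjRep.hasSum_tconv_inner (hU : IsProjRep σ U) {a : L → ℂ}
    (ha : Summable fun ν => ‖a ν‖) (v f : H) (ν : L) :
    HasSum (fun μ => a μ * ⟪U (ν - μ) v, f⟫_ℂ * σ μ (ν - μ)) ⟪U ν v, opSum U a f⟫_ℂ := by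
  simpa only [mul_assoc, hU.inner_map_sub] using hasSum_inner_opSum (U := U) ha (U ν v) f

/-- The integrated form is multiplicative. -/
lemma IsProjRep.opSum_opSum (hU : IsProjRep σ U) {a b : L → ℂ}
    (ha : Summable fun ν => ‖a ν‖) (hb : Summable fun ν => ‖b ν‖) (f : H) :
    HasSum (fun ν => tconv σ a b ν • U ν f) (opSum U a (opSum U b f)) := by
  have hs := summable_norm_tconv hU.norm_cocycle ha hb
  have h1 : Summable fun z : L × L =>
      (a z.1 * b (z.2 - z.1) * σ z.1 (z.2 - z.1)) • U z.2 f := by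
    refine Summable.of_norm ?_
    simpa only [norm_smul, LinearIsometry.norm_map] using hs.mul_right ‖f‖
  have h3 : ∀ μ, HasSum (fun ν => (a μ * b (ν - μ) * σ μ (ν - μ)) • U ν f)
      (a μ • U μ (opSum U b f)) := by
    intro μ
    have := ((hasSum_opSum (U := U) hb f).mapL (U μ).toContinuousLinearMap).const_smul (a μ)
    rw [← (Equiv.subRight μ).hasSum_iff] at this
    refine this.congr_fun fun ν => ?_
    -- Both iterated sums of one absolutely convergent double series are now compared: over `ν`
    -- first it is the composition, over `μ` first it is the convolution.
    simp [hU.map_map, smul_smul, mul_assoc]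
  have h4 : HasSum (fun μ => a μ • U μ (opSum U b f))
      (∑' z : L × L, (a z.1 * b (z.2 - z.1) * σ z.1 (z.2 - z.1)) • U z.2 f) :=
    HasSum.prod_fiberwise h1.hasSum h3
  have h5 := h4.unique (hasSum_opSum ha (opSum U b f))
  have h7 : HasSum (fun z : L × L =>
      (a z.2 * b (z.1 - z.2) * σ z.2 (z.1 - z.2)) • U z.1 f) (opSum U a (opSum U b f)) := by
    rw [← h5]
    exact (Equiv.prodComm L L).hasSum_iff.2 h1.hasSum
  have h8 : ∀ ν, HasSum (fun μ => (a μ * b (ν - μ) * σ μ (ν - μ)) • U ν f)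
      (tconv σ a b ν • U ν f) := fun ν =>
    (summable_tconv hU.norm_cocycle ha hb ν).hasSum.smul_const (U ν f)
  exact HasSum.prod_fiberwise h7 h8

/-- The hypotheses of `connesChern_aux`: `g` and `h` generate dual frames for a projective
representation, `p = (⟨g, U(ν) h⟩)` is summable. -/
structure IsDualPair (σ : L → L → ℂ) (U : L → H →ₗᵢ[ℂ] H) (g h : H) : Prop where
  rep : IsProjRep σ U
  expansion : ∀ f v : H, HasSum (fun ν => ⟪U ν g, f⟫_ℂ * ⟪v, U ν h⟫_ℂ) ⟪v, f⟫_ℂ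
  summable : Summable fun ν => ‖⟪U ν h, g⟫_ℂ‖

variable {g h : H}

/-- Complex conjugation exchanges the analysis and synthesis windows. -/
lemma IsDualPair.expansion' (D : IsDualPair σ U g h) (f v : H) :
    HasSum (fun ν => ⟪U ν h, f⟫_ℂ * ⟪v, U ν g⟫_ℂ) ⟪v, f⟫_ℂ := by
  have := (D.expansion v f).map (starRingEnd ℂ) Complex.continuous_conj
  rw [inner_conj_symm] at this
  refine this.congr_fun fun ν => ?_
  simp [mul_comm]

lemma IsDualPair.opSum_left (D : IsDualPair σ U g h) :
    opSum U (fun ν => ⟪U ν h, g⟫_ℂ) g = g :=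
  ext_inner_left ℂ fun v =>
    (hasSum_inner_opSum D.summable v g).unique (D.expansion' g v)

/-- Weak form of `P* h = h`; reflection turns the sum into the dual expansion of `f`. -/
lemma IsDualPair.inner_opSum (D : IsDualPair σ U g h) (f : H) :
    ⟪h, opSum U (fun ν => ⟪U ν h, g⟫_ℂ) f⟫_ℂ = ⟪h, f⟫_ℂ := by
  refine (hasSum_inner_opSum D.summable h f).unique ?_
  rw [← (Equiv.neg L).hasSum_iff]
  refine (D.expansion' f h).congr_fun fun ν => ?_
  simp [D.rep.reflect (-ν)]

lemma IsDualPair.tconv_self (D : IsDualPair σ U g h) :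
    tconv σ (fun ν => ⟪U ν h, g⟫_ℂ) (fun ν => ⟪U ν h, g⟫_ℂ) = fun ν => ⟪U ν h, g⟫_ℂ := by
  funext ν
  have := (D.rep.hasSum_tconv_inner D.summable h g ν).tsum_eq
  rwa [D.opSum_left] at this

/-- `P X P = 0` for the projection `P` and its derivative `X`, applied to `g = P g`. -/
lemma IsDualPair.opSum_deriv (D : IsDualPair σ U g h) (θ : L →+ ℂ)
    (hθ : Summable fun ν => ‖θ ν * ⟪U ν h, g⟫_ℂ‖) :
    opSum U (fun ν => ⟪U ν h, g⟫_ℂ) (opSum U (fun ν => θ ν * ⟪U ν h, g⟫_ℂ) g) = 0 := by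
  set p : L → ℂ := fun ν => ⟪U ν h, g⟫_ℂ with hp
  set x : L → ℂ := fun ν => θ ν * ⟪U ν h, g⟫_ℂ with hx
  have hP := D.summable
  have h1 := (D.rep.opSum_opSum hθ hP g).add (D.rep.opSum_opSum hP hθ g)
  -- Differentiating `p ♮ p = p` gives `X = XP + PX`; applied to `g = P g` this leaves `P X g = 0`.
  have h2 : opSum U x g = opSum U x (opSum U p g) + opSum U p (opSum U x g) := by
    refine (hasSum_opSum hθ g).unique (h1.congr_fun fun ν => ?_)
    rw [← add_smul, ← tconv_leibniz D.rep.norm_cocycle θ hP hθ, D.tconv_self]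
  rw [D.opSum_left] at h2
  simpa using h2

/-- Polarised form of the trace computation in `tconv_commutator`. -/
lemma IsDualPair.tconv_tconv (D : IsDualPair σ U g h) (θ₁ θ₂ : L →+ ℂ) {g₁ g₂ h₁ h₂ : H}
    (hs₁ : Summable fun ν => ‖θ₁ ν * ⟪U ν h, g⟫_ℂ‖)
    (h₁' : ∀ ν, θ₁ ν * ⟪U ν h, g⟫_ℂ = ⟪U ν h, g₁⟫_ℂ + ⟪U ν h₁, g⟫_ℂ)
    (h₂' : ∀ ν, θ₂ ν * ⟪U ν h, g⟫_ℂ = ⟪U ν h, g₂⟫_ℂ + ⟪U ν h₂, g⟫_ℂ) :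
    HasSum (fun μ => ⟪U μ h, g⟫_ℂ * tconv σ (fun ν => θ₁ ν * ⟪U ν h, g⟫_ℂ)
        (fun ν => θ₂ ν * ⟪U ν h, g⟫_ℂ) (0 - μ) * σ μ (0 - μ))
      (∑' ν, ⟪U ν h, g₁⟫_ℂ * ⟪h, U ν g₂⟫_ℂ + ⟪h₁, g₂⟫_ℂ) := by
  set p : L → ℂ := fun ν => ⟪U ν h, g⟫_ℂ with hp
  set x : L → ℂ := fun ν => θ₁ ν * ⟪U ν h, g⟫_ℂ with hx
  -- The right factor `∂₂p` is split by the connection, and the left factor acts on the vectors `g₂`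
  -- and `g` as the operator `X = opSum U x`.
  have e1 : ∀ ν, tconv σ x (fun ν => θ₂ ν * ⟪U ν h, g⟫_ℂ) ν =
      ⟪U ν h, opSum U x g₂⟫_ℂ + ⟪U ν h₂, opSum U x g⟫_ℂ := by
    intro ν
    have := ((D.rep.hasSum_tconv_inner hs₁ h g₂ ν).add
      (D.rep.hasSum_tconv_inner hs₁ h₂ g ν)).tsum_eq
    rw [← this]
    refine tsum_congr fun μ => ?_
    simp only [h₂']
    ring
  -- At `0` the outer convolution gives `⟪h, P X g₂⟫ + ⟪h₂, P X g⟫`. The second term vanishes, and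
  -- `P` drops out of the first.
  have e2 := (D.rep.hasSum_tconv_inner D.summable h (opSum U x g₂) 0).add
      (D.rep.hasSum_tconv_inner D.summable h₂ (opSum U x g) 0)
  rw [D.rep.map_zero, D.rep.map_zero, D.opSum_deriv θ₁ hs₁, D.inner_opSum, inner_zero_right,
    add_zero] at e2
  have e3 := hasSum_inner_opSum (U := U) hs₁ h g₂
  have e4 : HasSum (fun ν => ⟪U ν h₁, g⟫_ℂ * ⟪h, U ν g₂⟫_ℂ) ⟪h₁, g₂⟫_ℂ := by
    rw [← (Equiv.neg L).hasSum_iff]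
    refine (D.expansion' g₂ h₁).congr_fun fun ν => ?_
    simp [D.rep.reflect (-ν)]
  have e5 := e3.sub e4
  -- Splitting `x` by the connection as well, its `h₁` part resums to `⟪h₁, g₂⟫` by the frame
  -- expansion.
  have e6 : ∑' ν, ⟪U ν h, g₁⟫_ℂ * ⟪h, U ν g₂⟫_ℂ = ⟪h, opSum U x g₂⟫_ℂ - ⟪h₁, g₂⟫_ℂ := by
    rw [← e5.tsum_eq]
    refine tsum_congr fun ν => ?_
    rw [h₁']
    ring
  rw [e6, sub_add_cancel]
  refine e2.congr_fun fun μ => ?_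
  rw [e1]
  ring

/-- The trace of `p ♮ [∂₁p, ∂₂p]`, for derivations that are implemented by a connection. -/
theorem IsDualPair.tconv_commutator (D : IsDualPair σ U g h) (θ₁ θ₂ : L →+ ℂ) {g₁ g₂ h₁ h₂ : H}
    (hs₁ : Summable fun ν => ‖θ₁ ν * ⟪U ν h, g⟫_ℂ‖)
    (hs₂ : Summable fun ν => ‖θ₂ ν * ⟪U ν h, g⟫_ℂ‖)
    (h₁' : ∀ ν, θ₁ ν * ⟪U ν h, g⟫_ℂ = ⟪U ν h, g₁⟫_ℂ + ⟪U ν h₁, g⟫_ℂ)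
    (h₂' : ∀ ν, θ₂ ν * ⟪U ν h, g⟫_ℂ = ⟪U ν h, g₂⟫_ℂ + ⟪U ν h₂, g⟫_ℂ) :
    tconv σ (fun ν => ⟪U ν h, g⟫_ℂ)
      (tconv σ (fun ν => θ₁ ν * ⟪U ν h, g⟫_ℂ) (fun ν => θ₂ ν * ⟪U ν h, g⟫_ℂ) -
        tconv σ (fun ν => θ₂ ν * ⟪U ν h, g⟫_ℂ) (fun ν => θ₁ ν * ⟪U ν h, g⟫_ℂ)) 0 =
      ⟪h₁, g₂⟫_ℂ - ⟪h₂, g₁⟫_ℂ := by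
  have e := (D.tconv_tconv θ₁ θ₂ hs₁ h₁' h₂').sub (D.tconv_tconv θ₂ θ₁ hs₂ h₂' h₁')
  -- Reflection shows that the remaining series is symmetric in the indices `1, 2`, so it cancels in
  -- the commutator.
  have e7 : ∑' ν, ⟪U ν h, g₂⟫_ℂ * ⟪h, U ν g₁⟫_ℂ = ∑' ν, ⟪U ν h, g₁⟫_ℂ * ⟪h, U ν g₂⟫_ℂ := by
    rw [← (Equiv.neg L).tsum_eq]
    refine tsum_congr fun ν => ?_
    simp [D.rep.reflect (-ν)]
  rw [e7, add_sub_add_left_eq_sub] at e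
  rw [← e.tsum_eq]
  refine tsum_congr fun μ => ?_
  simp only [Pi.sub_apply]
  ring

end Complete

end Projective

/-! ### Time-frequency shifts and the short-time Fourier transform on the line -/

section RealLine

open scoped InnerProductSpace

/-- The Hilbert space `L²(ℝ)`. -/
abbrev L2R : Type := Lp ℂ 2 (volume : Measure ℝ)

/-- The character `t ↦ e^{2πitω}`. -/
def modChar (ω t : ℝ) : ℂ := Complex.exp (2 * Real.pi * Complex.I * (t * ω))

lemma norm_modChar (ω t : ℝ) : ‖modChar ω t‖ = 1 := by
  rw [modChar, Complex.norm_exp]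
  simp

lemma modChar_add_left (ω₁ ω₂ t : ℝ) : modChar (ω₁ + ω₂) t = modChar ω₁ t * modChar ω₂ t := by
  simp only [modChar, ← Complex.exp_add]
  push_cast
  ring_nf

lemma modChar_sub_right (ω s t : ℝ) :
    modChar ω (s - t) = modChar ω s * Complex.exp (-(2 * Real.pi * Complex.I * (t * ω))) := by
  simp only [modChar, ← Complex.exp_add]
  push_cast
  ring_nf

@[fun_prop]
lemma continuous_modChar : Continuous fun p : ℝ × ℝ => modChar p.1 p.2 := by
  unfold modChar
  fun_prop

lemma hasDerivAt_modChar (ω t : ℝ) :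
    HasDerivAt (modChar ω) (2 * Real.pi * Complex.I * ω * modChar ω t) t := by
  have h1 : HasDerivAt (fun t : ℝ => 2 * Real.pi * Complex.I * ((t : ℂ) * ω))
      (2 * Real.pi * Complex.I * (1 * ω)) t :=
    ((Complex.ofRealCLM.hasDerivAt (x := t)).mul_const (ω : ℂ)).const_mul _
  exact h1.cexp.congr_deriv (by rw [modChar]; ring)

lemma iteratedDeriv_modChar (ω : ℝ) (n : ℕ) :
    iteratedDeriv n (modChar ω) = fun t => (2 * Real.pi * Complex.I * ω) ^ n * modChar ω t := by
  induction n with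
  | zero => simp
  | succ n ih =>
    rw [iteratedDeriv_succ, ih]
    funext t
    rw [((hasDerivAt_modChar ω t).const_mul _).deriv]
    ring

lemma hasTemperateGrowth_modChar (ω : ℝ) : (modChar ω).HasTemperateGrowth := by
  refine ⟨?_, fun n => ⟨0, ‖(2 * Real.pi * Complex.I * ω : ℂ)‖ ^ n, fun t => ?_⟩⟩
  · unfold modChar
    have : ContDiff ℝ (⊤ : ℕ∞) fun t : ℝ => (t : ℂ) := Complex.ofRealCLM.contDiff
    fun_prop
  · rw [norm_iteratedFDeriv_eq_norm_iteratedDeriv, iteratedDeriv_modChar]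
    simp only [norm_mul, norm_pow, norm_modChar]
    simp

/-- The time-frequency shift on Schwartz functions. -/
def tfS (z : ℝ × ℝ) : 𝓢(ℝ, ℂ) →L[ℂ] 𝓢(ℝ, ℂ) :=
  SchwartzMap.smulLeftCLM ℂ (modChar z.2) ∘L SchwartzMap.compSubConstCLM ℂ z.1

lemma tfS_apply (z : ℝ × ℝ) (a : 𝓢(ℝ, ℂ)) (t : ℝ) : tfS z a t = modChar z.2 t * a (t - z.1) := by
  simp [tfS, SchwartzMap.smulLeftCLM_apply_apply (hasTemperateGrowth_modChar z.2)]

lemma memLp_tfShiftReal {f : ℝ → ℂ} (hf : MemLp f 2) (x ω : ℝ) :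
    MemLp (tfShiftReal x ω f) 2 := by
  have h1 : MemLp (fun t => f (t - x)) 2 :=
    hf.comp_measurePreserving (measurePreserving_sub_right volume x)
  refine h1.of_le ?_ (ae_of_all _ fun t => ?_)
  · refine AEStronglyMeasurable.mul (Continuous.aestronglyMeasurable ?_) h1.1
    exact continuous_modChar.comp (by fun_prop : Continuous fun t : ℝ => (ω, t))
  · change ‖modChar ω t * f (t - x)‖ ≤ _
    rw [norm_mul, norm_modChar, one_mul]

lemma tfShiftReal_congr {f g : ℝ → ℂ} (h : f =ᵐ[volume] g) (x ω : ℝ) :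
    tfShiftReal x ω f =ᵐ[volume] tfShiftReal x ω g := by
  have := (measurePreserving_sub_right volume x).quasiMeasurePreserving.ae_eq_comp h
  filter_upwards [this] with t ht
  simp only [tfShiftReal]
  rw [show f (t - x) = g (t - x) from ht]

/-- The time-frequency shift on `L²(ℝ)`. -/
def tfL (z : ℝ × ℝ) : L2R →ₗᵢ[ℂ] L2R where
  toFun f := (memLp_tfShiftReal (Lp.memLp f) z.1 z.2).toLp
  map_add' f g := by
    rw [← MemLp.toLp_add]
    refine MemLp.toLp_congr _ _ ?_
    filter_upwards [tfShiftReal_congr (Lp.coeFn_add f g) z.1 z.2] with t ht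
    rw [ht]
    simp [tfShiftReal, mul_add]
  map_smul' c f := by
    rw [RingHom.id_apply, ← MemLp.toLp_const_smul]
    refine MemLp.toLp_congr _ _ ?_
    filter_upwards [tfShiftReal_congr (Lp.coeFn_smul c f) z.1 z.2] with t ht
    rw [ht]
    simp [tfShiftReal, mul_left_comm]
  norm_map' f := by
    change ‖(memLp_tfShiftReal (Lp.memLp f) z.1 z.2).toLp‖ = _
    rw [Lp.norm_toLp, Lp.norm_def]
    congr 1
    have h := eLpNorm_comp_measurePreserving (p := 2) (Lp.aestronglyMeasurable f)
      (measurePreserving_sub_right volume z.1)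
    rw [← h]
    refine eLpNorm_congr_norm_ae (ae_of_all _ fun t => ?_)
    change ‖modChar z.2 t * f (t - z.1)‖ = _
    rw [norm_mul, norm_modChar, one_mul]
    rfl

lemma coeFn_tfL (z : ℝ × ℝ) (f : L2R) : tfL z f =ᵐ[volume] tfShiftReal z.1 z.2 f :=
  (memLp_tfShiftReal (Lp.memLp f) z.1 z.2).coeFn_toLp

lemma tfL_toLp (z : ℝ × ℝ) {f : ℝ → ℂ} (hf : MemLp f 2) :
    tfL z hf.toLp = (memLp_tfShiftReal hf z.1 z.2).toLp :=
  MemLp.toLp_congr (memLp_tfShiftReal (Lp.memLp _) z.1 z.2) _ (tfShiftReal_congr hf.coeFn_toLp _ _)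

lemma tfL_schwartz (z : ℝ × ℝ) (a : 𝓢(ℝ, ℂ)) : tfL z (a.toLp 2 (volume : Measure ℝ)) =
    (tfS z a).toLp 2 (volume : Measure ℝ) := by
  change tfL z (a.memLp 2).toLp = ((tfS z a).memLp 2).toLp
  rw [tfL_toLp]
  refine MemLp.toLp_congr _ _ (ae_of_all _ fun t => ?_)
  rw [tfS_apply]
  rfl

lemma tfL_zero (f : L2R) : tfL 0 f = f := by
  refine Lp.ext ((coeFn_tfL 0 f).trans (ae_of_all _ fun t => ?_))
  simp [tfShiftReal]

lemma tfL_tfL (z w : ℝ × ℝ) (f : L2R) :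
    tfL z (tfL w f) =
      Complex.exp (-(2 * Real.pi * Complex.I * (z.1 * w.2))) • tfL (z + w) f := by
  refine Lp.ext ?_
  filter_upwards [coeFn_tfL z (tfL w f), tfShiftReal_congr (coeFn_tfL w f) z.1 z.2,
    Lp.coeFn_smul (Complex.exp (-(2 * Real.pi * Complex.I * (z.1 * w.2)))) (tfL (z + w) f),
    coeFn_tfL (z + w) f] with t h1 h2 h3 h4
  rw [h1, h2, h3, Pi.smul_apply, h4]
  change modChar z.2 t * (modChar w.2 (t - z.1) * f (t - z.1 - w.1)) =
    _ • (modChar (z.2 + w.2) t * f (t - (z.1 + w.1)))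
  rw [modChar_sub_right, modChar_add_left, smul_eq_mul, sub_sub]
  ring

lemma l2inner_eq_inner {f g : ℝ → ℂ} (hf : MemLp f 2) (hg : MemLp g 2) :
    l2inner volume f g = ⟪hg.toLp, hf.toLp⟫_ℂ := by
  rw [L2.inner_def, l2inner]
  refine integral_congr_ae ?_
  filter_upwards [hf.coeFn_toLp, hg.coeFn_toLp] with t h1 h2
  rw [h1, h2, RCLike.inner_apply]

lemma l2inner_tfShiftReal {f g : ℝ → ℂ} (hf : MemLp f 2) (hg : MemLp g 2) (x ω : ℝ) :
    l2inner volume f (tfShiftReal x ω g) = ⟪tfL (x, ω) hg.toLp, hf.toLp⟫_ℂ := by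
  rw [tfL_toLp, l2inner_eq_inner hf (memLp_tfShiftReal hg x ω)]

/-- The short-time Fourier transform of `g ∈ L²(ℝ)` with Schwartz window `φ`. -/
def stft (φ : 𝓢(ℝ, ℂ)) (g : L2R) (z : ℝ × ℝ) : ℂ := ⟪tfL z (φ.toLp 2 (volume : Measure ℝ)), g⟫_ℂ

lemma stft_eq_integral (φ : 𝓢(ℝ, ℂ)) (g : L2R) (z : ℝ × ℝ) :
    stft φ g z = ∫ t, conj (modChar z.2 t * φ (t - z.1)) * g t := by
  rw [stft, tfL_schwartz, L2.inner_def]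
  refine integral_congr_ae ?_
  filter_upwards [(tfS z φ).coeFn_toLp 2] with t ht
  rw [ht, tfS_apply, RCLike.inner_apply, mul_comm]

lemma norm_stft_le (φ : 𝓢(ℝ, ℂ)) (g : L2R) (z : ℝ × ℝ) :
    ‖stft φ g z‖ ≤ ‖φ.toLp 2 (volume : Measure ℝ)‖ * ‖g‖ := by
  refine (norm_inner_le_norm _ _).trans ?_
  rw [LinearIsometry.norm_map]

end RealLine

/-! ### Continuity and rapid decay of short-time Fourier transforms -/

section Decay

open scoped InnerProductSpace FourierTransform

lemma continuous_stft_schwartz (φ a : 𝓢(ℝ, ℂ)) : Continuous (stft φ (a.toLp 2 (volume :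
    Measure ℝ))) := by
  have h : stft φ (a.toLp 2 (volume : Measure ℝ)) = fun z => ∫ t, conj (modChar z.2 t *
      φ (t - z.1)) * a t := by
    funext z
    rw [stft_eq_integral]
    refine integral_congr_ae ?_
    filter_upwards [a.coeFn_toLp 2] with t ht
    rw [ht]
  rw [h]
  obtain ⟨C, hC⟩ : ∃ C, ∀ t, ‖φ t‖ ≤ C :=
    ⟨_, fun t => φ.toBoundedContinuousFunction.norm_coe_le_norm t⟩
  refine continuous_of_dominated (bound := fun t => C * ‖a t‖) (fun z => ?_) (fun z => ?_)
    (a.integrable.norm.const_mul C) (ae_of_all _ fun t => ?_)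
  · refine Continuous.aestronglyMeasurable ?_
    have h1 : Continuous fun t => modChar z.2 t :=
      continuous_modChar.comp (by fun_prop : Continuous fun t : ℝ => (z.2, t))
    have h2 : Continuous fun t => φ (t - z.1) := φ.continuous.comp (by fun_prop)
    exact (Complex.continuous_conj.comp (h1.mul h2)).mul a.continuous
  · refine ae_of_all _ fun t => ?_
    rw [norm_mul, RCLike.norm_conj, norm_mul, norm_modChar, one_mul]
    gcongr
    exact hC _
  · have h1 : Continuous fun z : ℝ × ℝ => modChar z.2 t :=
      continuous_modChar.comp (by fun_prop : Continuous fun z : ℝ × ℝ => (z.2, t))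
    have h2 : Continuous fun z : ℝ × ℝ => φ (t - z.1) := φ.continuous.comp (by fun_prop)
    exact (Complex.continuous_conj.comp (h1.mul h2)).mul continuous_const

/-- Both shifted vectors have norm `‖a‖`, so the squared distance is governed by the real part of
their inner product, a continuous short-time Fourier transform. -/
lemma continuous_tfL (a : 𝓢(ℝ, ℂ)) : Continuous fun z => tfL z (a.toLp 2 (volume : Measure ℝ)) := by
  refine continuous_iff_continuousAt.2 fun w => ?_
  rw [ContinuousAt, tendsto_iff_norm_sub_tendsto_zero]
  have h1 : ∀ z, ‖tfL z (a.toLp 2 (volume : Measure ℝ)) - tfL w (a.toLp 2 (volume : Measure ℝ))‖ =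
      √(2 * ‖a.toLp 2 (volume : Measure ℝ)‖ ^ 2 - 2 * (stft a ((tfS w a).toLp 2 (volume :
          Measure ℝ)) z).re) := by
    intro z
    refine (Real.sqrt_sq (norm_nonneg _)).symm.trans ?_
    rw [@norm_sub_sq ℂ,
      LinearIsometry.norm_map, LinearIsometry.norm_map, ← tfL_schwartz]
    congr 1
    simp only [stft, RCLike.re_to_complex]
    ring
  have h2 : Continuous fun z =>
      √(2 * ‖a.toLp 2 (volume : Measure ℝ)‖ ^ 2 - 2 * (stft a ((tfS w a).toLp 2 (volume :
          Measure ℝ)) z).re) := by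
    have := continuous_stft_schwartz a (tfS w a)
    fun_prop
  simp only [h1]
  have h3 := h2.tendsto w
  simp only [← h1, sub_self, norm_zero] at h3
  simpa only [h1] using h3

lemma continuous_stft (φ : 𝓢(ℝ, ℂ)) (g : L2R) : Continuous (stft φ g) :=
  (continuous_tfL φ).inner continuous_const

lemma exists_schwartz_bound (a : 𝓢(ℝ, ℂ)) (N : ℕ) :
    ∃ C, 0 ≤ C ∧ ∀ t, (1 + |t|) ^ N * ‖a t‖ ≤ C := by
  refine ⟨2 ^ N * (Finset.Iic (N, 0)).sup (fun m => SchwartzMap.seminorm ℝ m.1 m.2) a,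
    by positivity, fun t => ?_⟩
  have := SchwartzMap.one_add_le_sup_seminorm_apply (𝕜 := ℝ) (m := (N, 0)) (k := N) (n := 0)
    le_rfl le_rfl a t
  simpa using this

lemma one_add_abs_le (x t : ℝ) : 1 + |x| ≤ (1 + |t - x|) * (1 + |t|) := by
  have h : |x| ≤ |t - x| + |t| := by
    have := abs_sub_abs_le_abs_sub x t
    rw [abs_sub_comm] at this
    linarith
  nlinarith [abs_nonneg (t - x), abs_nonneg t, mul_nonneg (abs_nonneg (t - x)) (abs_nonneg t)]

lemma exists_stft_decay_time (φ a : 𝓢(ℝ, ℂ)) (N : ℕ) :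
    ∃ C, 0 ≤ C ∧ ∀ z : ℝ × ℝ, (1 + |z.1|) ^ N * ‖stft φ (a.toLp 2 (volume : Measure ℝ)) z‖ ≤ C := by
  obtain ⟨C₁, hC₁, h₁⟩ := exists_schwartz_bound φ N
  -- `N` powers absorb the weight in `x`; two more make the integrand integrable in `t`.
  obtain ⟨C₂, hC₂, h₂⟩ := exists_schwartz_bound a (N + 2)
  have hint : Integrable fun t : ℝ => C₁ * C₂ * (1 + ‖t‖) ^ (-2 : ℝ) :=
    (integrable_one_add_norm (by simp)).const_mul _
  refine ⟨∫ t : ℝ, C₁ * C₂ * (1 + ‖t‖) ^ (-2 : ℝ), integral_nonneg fun t => by positivity,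
    fun z => ?_⟩
  have h : (1 + |z.1|) ^ N * ‖stft φ (a.toLp 2 (volume : Measure ℝ)) z‖ =
      ‖∫ t, ((1 + |z.1|) ^ N : ℝ) * (conj (modChar z.2 t * φ (t - z.1)) *
        (a.toLp 2 (volume : Measure ℝ) : ℝ → ℂ) t)‖ := by
    rw [stft_eq_integral, integral_const_mul, norm_mul, Complex.norm_real,
      Real.norm_of_nonneg (by positivity)]
  rw [h]
  refine norm_integral_le_of_norm_le hint ?_
  filter_upwards [a.coeFn_toLp 2] with t ht
  rw [ht, norm_mul, norm_mul, RCLike.norm_conj, norm_mul, norm_modChar, one_mul, Complex.norm_real,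
    Real.norm_of_nonneg (by positivity), Real.rpow_neg (by positivity), Real.rpow_ofNat,
    Real.norm_eq_abs]
  have h3 : (1 + |z.1|) ^ N ≤ (1 + |t - z.1|) ^ N * (1 + |t|) ^ N := by
    rw [← mul_pow]
    gcongr
    exact one_add_abs_le _ _
  rw [← div_eq_mul_inv, le_div_iff₀ (by positivity)]
  calc (1 + |z.1|) ^ N * (‖φ (t - z.1)‖ * ‖a t‖) * (1 + |t|) ^ 2
      ≤ ((1 + |t - z.1|) ^ N * (1 + |t|) ^ N) * (‖φ (t - z.1)‖ * ‖a t‖) * (1 + |t|) ^ 2 := by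
        gcongr
    _ = ((1 + |t - z.1|) ^ N * ‖φ (t - z.1)‖) * ((1 + |t|) ^ (N + 2) * ‖a t‖) := by ring
    _ ≤ C₁ * C₂ := by
        gcongr
        · exact h₁ _
        · exact h₂ _

lemma fourier_tfS (z : ℝ × ℝ) (a : 𝓢(ℝ, ℂ)) :
    𝓕 (tfS z a) = modChar z.2 z.1 • tfS (z.2, -z.1) (𝓕 a) := by
  ext ξ
  rw [smul_apply, tfS_apply, SchwartzMap.fourier_coe, SchwartzMap.fourier_coe,
    Real.fourier_real_eq_integral_exp_smul, Real.fourier_real_eq_integral_exp_smul,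
    ← integral_add_right_eq_self _ z.1]
  simp only [smul_eq_mul]
  rw [← integral_const_mul, ← integral_const_mul]
  congr 1
  funext t
  rw [tfS_apply, add_sub_cancel_right]
  simp only [modChar, ← mul_assoc, ← Complex.exp_add]
  congr 2
  push_cast
  ring

/-- The Fourier transform rotates the time-frequency plane, so decay in time of the transformed pair
is decay in frequency of the original one. -/
lemma norm_stft_fourier (φ a : 𝓢(ℝ, ℂ)) (z : ℝ × ℝ) :
    ‖stft φ (a.toLp 2 (volume : Measure ℝ)) z‖ = ‖stft (𝓕 φ) ((𝓕 a).toLp 2 (volume : Measure ℝ))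
        (z.2, -z.1)‖ := by
  rw [stft, stft, tfL_schwartz, tfL_schwartz, ← SchwartzMap.inner_fourier_toL2_eq, fourier_tfS]
  change ‖⟪modChar z.2 z.1 • (tfS (z.2, -z.1) (𝓕 φ)).toLp 2 (volume : Measure ℝ), _⟫_ℂ‖ = _
  rw [inner_smul_left, norm_mul, RCLike.norm_conj, norm_modChar, one_mul]

lemma exists_stft_decay (φ a : 𝓢(ℝ, ℂ)) (N : ℕ) :
    ∃ C, 0 ≤ C ∧ ∀ z : ℝ × ℝ, (1 + |z.1| + |z.2|) ^ N * ‖stft φ (a.toLp 2 (volume : Measure ℝ)) z‖ ≤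
        C := by
  obtain ⟨C₁, hC₁, h₁⟩ := exists_stft_decay_time φ a N
  obtain ⟨C₂, hC₂, h₂⟩ := exists_stft_decay_time (𝓕 φ) (𝓕 a) N
  refine ⟨2 ^ N * (C₁ + C₂), by positivity, fun z => ?_⟩
  have h₃ := h₁ z
  have h₄ := h₂ (z.2, -z.1)
  rw [← norm_stft_fourier] at h₄
  have h₅ : (1 + |z.1| + |z.2|) ^ N ≤ 2 ^ N * ((1 + |z.1|) ^ N + (1 + |z.2|) ^ N) := by
    have n1 : 0 ≤ (1 + |z.1|) ^ N := by positivity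
    have n2 : 0 ≤ (1 + |z.2|) ^ N := by positivity
    rcases le_total |z.1| |z.2| with h | h
    · calc (1 + |z.1| + |z.2|) ^ N ≤ (2 * (1 + |z.2|)) ^ N := by gcongr; linarith
        _ = 2 ^ N * (1 + |z.2|) ^ N := mul_pow _ _ _
        _ ≤ _ := by gcongr; linarith
    · calc (1 + |z.1| + |z.2|) ^ N ≤ (2 * (1 + |z.1|)) ^ N := by gcongr; linarith
        _ = 2 ^ N * (1 + |z.1|) ^ N := mul_pow _ _ _
        _ ≤ _ := by gcongr; linarith
  calc _ ≤ 2 ^ N * ((1 + |z.1|) ^ N + (1 + |z.2|) ^ N) * ‖stft φ (a.toLp 2 (volume :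
      Measure ℝ)) z‖ := by gcongr
    _ = 2 ^ N * ((1 + |z.1|) ^ N * ‖stft φ (a.toLp 2 (volume : Measure ℝ)) z‖ +
        (1 + |z.2|) ^ N * ‖stft φ (a.toLp 2 (volume : Measure ℝ)) z‖) := by ring
    _ ≤ _ := by gcongr

end Decay

/-! ### Moyal's identity and the inversion formula -/

section Moyal

open scoped InnerProductSpace FourierTransform

/-- Pointwise complex conjugation of Schwartz functions. -/
def conjS (a : 𝓢(ℝ, ℂ)) : 𝓢(ℝ, ℂ) :=
  SchwartzMap.postcompCLM (𝕜 := ℝ) (Complex.conjCLE : ℂ →L[ℝ] ℂ) a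

lemma conjS_apply (a : 𝓢(ℝ, ℂ)) (t : ℝ) : conjS a t = conj (a t) := by
  simp [conjS]

/-- The product of a Schwartz function with the conjugate of a translated one. -/
def windowed (φ a : 𝓢(ℝ, ℂ)) (x : ℝ) : 𝓢(ℝ, ℂ) :=
  SchwartzMap.pairing (ContinuousLinearMap.mul ℂ ℂ) (conjS (SchwartzMap.compSubConstCLM ℂ x φ)) a

lemma windowed_apply (φ a : 𝓢(ℝ, ℂ)) (x t : ℝ) :
    windowed φ a x t = conj (φ (t - x)) * a t := by
  simp [windowed, conjS_apply, SchwartzMap.pairing_apply_apply]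

lemma integrable_windowed (φ : 𝓢(ℝ, ℂ)) (g : L2R) (x : ℝ) :
    Integrable fun t => conj (φ (t - x)) * g t := by
  have h1 : MemLp (conjS (SchwartzMap.compSubConstCLM ℂ x φ)) 2 :=
    (conjS (SchwartzMap.compSubConstCLM ℂ x φ)).memLp 2
  refine (h1.integrable_mul (Lp.memLp g)).congr (ae_of_all _ fun t => ?_)
  simp [conjS_apply]

lemma stft_eq_fourier (φ : 𝓢(ℝ, ℂ)) (g : L2R) (x ω : ℝ) :
    stft φ g (x, ω) = 𝓕 (fun t => conj (φ (t - x)) * g t) ω := by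
  rw [stft_eq_integral, Real.fourier_real_eq_integral_exp_smul]
  congr 1
  funext t
  rw [map_mul, smul_eq_mul, mul_assoc]
  congr 1
  rw [modChar, ← Complex.exp_conj]
  congr 1
  simp only [map_mul, Complex.conj_I, Complex.conj_ofReal, map_ofNat]
  push_cast
  ring

lemma stft_schwartz_eq_fourier (φ a : 𝓢(ℝ, ℂ)) (x ω : ℝ) :
    stft φ (a.toLp 2 (volume : Measure ℝ)) (x, ω) = 𝓕 (windowed φ a x) ω := by
  rw [stft_eq_fourier, SchwartzMap.fourier_coe]
  refine Real.fourier_congr_ae ?_ ω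
  filter_upwards [a.coeFn_toLp 2] with t ht
  rw [ht, windowed_apply]

/-- Parseval for a merely integrable `f`: the transform is moved onto the Schwartz function `𝓕 k`,
where Fourier inversion applies. -/
lemma integral_fourier_mul_conj_fourier {f : ℝ → ℂ} (hf : Integrable f) (k : 𝓢(ℝ, ℂ)) :
    ∫ ω, conj (𝓕 f ω) * 𝓕 k ω = ∫ t, conj (f t) * k t := by
  have h := VectorFourier.integral_sesq_fourierIntegral_eq_neg_flip (innerSL ℂ (E := ℂ))
    (L := innerₗ ℝ) Real.continuous_fourierChar continuous_inner hf
    ((𝓕 k).integrable (μ := volume))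
  have h2 : ∀ t, VectorFourier.fourierIntegral Real.fourierChar volume (-(innerₗ ℝ).flip)
      (𝓕 k : 𝓢(ℝ, ℂ)) t = k t := by
    intro t
    conv_rhs => rw [← FourierTransform.fourierInv_fourier_eq (F := 𝓢(ℝ, ℂ)) k]
    rw [SchwartzMap.fourierInv_coe]
    simp [FourierTransformInv.fourierInv]
  simp only [h2, innerSL_apply_apply, RCLike.inner_apply] at h
  exact (integral_congr_ae (ae_of_all _ fun ω => mul_comm _ _)).trans
    (h.trans (integral_congr_ae (ae_of_all _ fun t => mul_comm _ _)))

lemma integral_stft_mul_conj (φ a : 𝓢(ℝ, ℂ)) (g : L2R) (x : ℝ) :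
    ∫ ω, conj (stft φ g (x, ω)) * stft φ (a.toLp 2 (volume : Measure ℝ)) (x, ω) =
      ∫ t, conj (g t) * a t * (φ (t - x) * conj (φ (t - x))) := by
  simp only [stft_eq_fourier φ g, stft_schwartz_eq_fourier]
  rw [integral_fourier_mul_conj_fourier (integrable_windowed φ g x)]
  congr 1
  funext t
  rw [windowed_apply, map_mul, Complex.conj_conj]
  ring

/-- Moyal's identity. -/
lemma integral_stft_mul_stft (φ a : 𝓢(ℝ, ℂ)) (g : L2R) (hg : Integrable (stft φ g)) :
    ∫ z, conj (stft φ g z) * stft φ (a.toLp 2 (volume : Measure ℝ)) z =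
      ⟪g, a.toLp 2 (volume : Measure ℝ)⟫_ℂ * ⟪φ.toLp 2 (volume : Measure ℝ), φ.toLp 2 (volume :
          Measure ℝ)⟫_ℂ := by
  have hint : Integrable fun z => conj (stft φ g z) * stft φ (a.toLp 2 (volume : Measure ℝ)) z := by
    refine Integrable.mul_bdd (c := ‖φ.toLp 2 (volume : Measure ℝ)‖ * ‖a.toLp 2 (volume :
        Measure ℝ)‖)
      ?_ (continuous_stft φ _).aestronglyMeasurable (ae_of_all _ fun z => norm_stft_le φ _ z)
    exact Complex.conjLIE.toContinuousLinearEquiv.toContinuousLinearMap.integrable_comp hg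
  have hu : Integrable fun t => conj (g t) * a t := by
    refine ((Lp.memLp g).star.integrable_mul (a.memLp 2)).congr (ae_of_all _ fun t => ?_)
    simp
  have hv : Integrable fun t => φ (-t) * conj (φ (-t)) := by
    have : Integrable fun t => φ t * conj (φ t) := by
      refine ((φ.memLp 2).integrable_mul ((conjS φ).memLp 2)).congr (ae_of_all _ fun t => ?_)
      simp [conjS_apply]
    exact this.comp_neg
  -- After Parseval in `ω`, the function of `x` is the convolution of `conj g · a` with the
  -- reflected `|φ|²`; its integral factors.
  have hc := integral_convolution (ContinuousLinearMap.mul ℂ ℂ) hu hv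
  rw [Measure.volume_eq_prod] at hint ⊢
  rw [integral_prod _ hint]
  simp only [integral_stft_mul_conj]
  simp only [convolution_def, ContinuousLinearMap.mul_apply', neg_sub] at hc
  rw [hc]
  congr 1
  · rw [L2.inner_def]
    refine integral_congr_ae ?_
    filter_upwards [a.coeFn_toLp 2] with t ht
    rw [ht, RCLike.inner_apply, mul_comm]
  · rw [integral_neg_eq_self (fun t => φ t * conj (φ t))]
    exact (SchwartzMap.inner_toL2_toL2_eq φ φ).symm

lemma integrable_stft_smul_tfL (φ : 𝓢(ℝ, ℂ)) {g : L2R} (hg : Integrable (stft φ g)) :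
    Integrable fun z => stft φ g z • tfL z (φ.toLp 2 (volume : Measure ℝ)) :=
  hg.smul_bdd ‖φ.toLp 2 (volume : Measure ℝ)‖ (continuous_tfL φ).aestronglyMeasurable
    (ae_of_all _ fun z => ((tfL z).norm_map _).le)

/-- The inversion formula for the short-time Fourier transform. -/
lemma integral_stft_smul_tfL (φ : 𝓢(ℝ, ℂ)) {g : L2R} (hg : Integrable (stft φ g)) :
    ∫ z, stft φ g z • tfL z (φ.toLp 2 (volume : Measure ℝ)) =
      ⟪φ.toLp 2 (volume : Measure ℝ), φ.toLp 2 (volume : Measure ℝ)⟫_ℂ • g := by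
  have hd : Dense (Set.range fun a : 𝓢(ℝ, ℂ) => a.toLp 2 (volume : Measure ℝ)) :=
    SchwartzMap.denseRange_toLpCLM (p := 2) (by simp)
  refine hd.eq_of_inner_left ℂ ?_
  rintro _ ⟨a, rfl⟩
  have h := integral_stft_mul_stft φ a g hg
  rw [inner_smul_left, inner_conj_symm, mul_comm, ← h, ← inner_conj_symm,
    ← integral_inner (integrable_stft_smul_tfL φ hg), ← integral_conj]
  congr 1
  funext z
  rw [inner_smul_right, map_mul, inner_conj_symm]
  rfl

end Moyal

/-! ### The connection given by position and differentiation -/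

section Connection

open scoped InnerProductSpace

lemma hasTemperateGrowth_two_pi_I_mul :
    (fun t : ℝ => 2 * Real.pi * Complex.I * (t : ℂ)).HasTemperateGrowth := by
  fun_prop

/-- The operator `a(t) ↦ 2πit a(t)`. -/
def posS : 𝓢(ℝ, ℂ) →L[ℂ] 𝓢(ℝ, ℂ) :=
  SchwartzMap.smulLeftCLM ℂ fun t : ℝ => 2 * Real.pi * Complex.I * (t : ℂ)

/-- The operator `a ↦ a'`. -/
def derS : 𝓢(ℝ, ℂ) →L[ℂ] 𝓢(ℝ, ℂ) := SchwartzMap.derivCLM ℂ ℂ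

lemma posS_apply (a : 𝓢(ℝ, ℂ)) (t : ℝ) : posS a t = 2 * Real.pi * Complex.I * t * a t := by
  simp [posS, SchwartzMap.smulLeftCLM_apply_apply hasTemperateGrowth_two_pi_I_mul]

lemma derS_apply (a : 𝓢(ℝ, ℂ)) (t : ℝ) : derS a t = deriv a t := rfl

lemma posS_tfS (z : ℝ × ℝ) (a : 𝓢(ℝ, ℂ)) :
    posS (tfS z a) = tfS z (posS a) + (2 * Real.pi * Complex.I * z.1) • tfS z a := by
  ext t
  simp only [posS_apply, tfS_apply, add_apply, smul_apply, smul_eq_mul]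
  push_cast
  ring

lemma derS_tfS (z : ℝ × ℝ) (a : 𝓢(ℝ, ℂ)) :
    derS (tfS z a) = tfS z (derS a) + (2 * Real.pi * Complex.I * z.2) • tfS z a := by
  ext t
  have h1 : HasDerivAt (fun t => a (t - z.1)) (deriv a (t - z.1)) t :=
    (a.hasDerivAt (t - z.1)).comp_sub_const t z.1
  have h2 : HasDerivAt (tfS z a) _ t :=
    ((hasDerivAt_modChar z.2 t).mul h1).congr_of_eventuallyEq
      (Eventually.of_forall fun t => tfS_apply z a t)
  simp only [derS_apply, tfS_apply, add_apply, smul_apply, smul_eq_mul]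
  rw [h2.deriv]
  ring

/-- The canonical commutation relation; its scalar becomes the curvature. -/
lemma posS_derS (a : 𝓢(ℝ, ℂ)) :
    derS (posS a) = posS (derS a) + (2 * Real.pi * Complex.I) • a := by
  ext t
  have h1 : HasDerivAt (fun t : ℝ => 2 * Real.pi * Complex.I * (t : ℂ))
      (2 * Real.pi * Complex.I * 1) t := (Complex.ofRealCLM.hasDerivAt (x := t)).const_mul _
  have h2 : HasDerivAt (posS a) _ t :=
    (h1.mul (a.hasDerivAt t)).congr_of_eventuallyEq
      (Eventually.of_forall fun t => posS_apply a t)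
  simp only [derS_apply, posS_apply, add_apply, smul_apply, smul_eq_mul]
  rw [h2.deriv]
  ring

lemma inner_schwartz (a b : 𝓢(ℝ, ℂ)) :
    ⟪a.toLp 2 (volume : Measure ℝ), b.toLp 2 (volume : Measure ℝ)⟫_ℂ = ∫ t, conj (a t) * b t := by
  refine (SchwartzMap.inner_toL2_toL2_eq a b).trans (integral_congr_ae (ae_of_all _ fun t => ?_))
  simp [RCLike.inner_apply, mul_comm]

lemma inner_posS (a b : 𝓢(ℝ, ℂ)) :
    ⟪a.toLp 2 (volume : Measure ℝ), (posS b).toLp 2 (volume : Measure ℝ)⟫_ℂ =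
        -⟪(posS a).toLp 2 (volume : Measure ℝ), b.toLp 2 (volume : Measure ℝ)⟫_ℂ := by
  rw [inner_schwartz, inner_schwartz, ← integral_neg]
  congr 1
  funext t
  simp only [posS_apply, map_mul, Complex.conj_I, Complex.conj_ofReal, map_ofNat]
  ring

lemma deriv_conjS (a : 𝓢(ℝ, ℂ)) (t : ℝ) : deriv (conjS a) t = conj (deriv a t) := by
  have h := Complex.conjCLE.toContinuousLinearMap.hasFDerivAt.comp_hasDerivAt t (a.hasDerivAt t)
  have h2 : HasDerivAt (conjS a) _ t :=
    h.congr_of_eventuallyEq (Eventually.of_forall fun t => conjS_apply a t)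
  exact h2.deriv

lemma inner_derS (a b : 𝓢(ℝ, ℂ)) :
    ⟪a.toLp 2 (volume : Measure ℝ), (derS b).toLp 2 (volume : Measure ℝ)⟫_ℂ =
        -⟪(derS a).toLp 2 (volume : Measure ℝ), b.toLp 2 (volume : Measure ℝ)⟫_ℂ := by
  rw [inner_schwartz, inner_schwartz]
  have h := SchwartzMap.integral_mul_deriv_eq_neg_deriv_mul (conjS a) b
  simpa only [conjS_apply, deriv_conjS, derS_apply] using h

/-- The map `a ↦ (a, 2πit a, a')`, from Schwartz functions to triples of `L²` functions. -/
def gradL : 𝓢(ℝ, ℂ) →ₗ[ℂ] L2R × L2R × L2R :=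
  let ι : 𝓢(ℝ, ℂ) →ₗ[ℂ] L2R := (SchwartzMap.toLpCLM ℂ ℂ 2 (volume : Measure ℝ)).toLinearMap
  ι.prod ((ι ∘ₗ posS.toLinearMap).prod (ι ∘ₗ derS.toLinearMap))

lemma gradL_apply (a : 𝓢(ℝ, ℂ)) :
    gradL a = (a.toLp 2 (volume : Measure ℝ), (posS a).toLp 2 (volume : Measure ℝ),
        (derS a).toLp 2 (volume : Measure ℝ)) := rfl

/-- The closure of the joint graph of `2πit` and `d/dt`. -/
def gradGraph : Submodule ℂ (L2R × L2R × L2R) := (LinearMap.range gradL).topologicalClosure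

/-- Closed conditions on pairs in the graph need checking only on Schwartz functions; this avoids
weak derivatives of `L²` functions. -/
lemma gradGraph_induction {P : (L2R × L2R × L2R) → (L2R × L2R × L2R) → Prop}
    (hc : IsClosed {x : (L2R × L2R × L2R) × (L2R × L2R × L2R) | P x.1 x.2})
    (hS : ∀ a b, P (gradL a) (gradL b)) {x y : L2R × L2R × L2R}
    (hx : x ∈ gradGraph) (hy : y ∈ gradGraph) : P x y := by
  have h : (x, y) ∈ closure ((Set.range gradL) ×ˢ (Set.range gradL)) := by
    rw [closure_prod_eq]
    exact ⟨hx, hy⟩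
  refine closure_minimal ?_ hc h
  rintro ⟨_, _⟩ ⟨⟨a, rfl⟩, ⟨b, rfl⟩⟩
  exact hS a b

lemma toLp_add' (a b : 𝓢(ℝ, ℂ)) :
    (a + b).toLp 2 (volume : Measure ℝ) =
      a.toLp 2 (volume : Measure ℝ) + b.toLp 2 (volume : Measure ℝ) := rfl

lemma toLp_smul' (c : ℂ) (a : 𝓢(ℝ, ℂ)) :
    (c • a).toLp 2 (volume : Measure ℝ) = c • a.toLp 2 (volume : Measure ℝ) := rfl

lemma gradGraph_leibniz_pos (z : ℝ × ℝ) {x y : L2R × L2R × L2R}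
    (hx : x ∈ gradGraph) (hy : y ∈ gradGraph) :
    2 * Real.pi * Complex.I * z.1 * ⟪tfL z y.1, x.1⟫_ℂ =
      ⟪tfL z y.1, x.2.1⟫_ℂ + ⟪tfL z y.2.1, x.1⟫_ℂ := by
  refine gradGraph_induction (P := fun x y => 2 * Real.pi * Complex.I * z.1 * ⟪tfL z y.1, x.1⟫_ℂ =
      ⟪tfL z y.1, x.2.1⟫_ℂ + ⟪tfL z y.2.1, x.1⟫_ℂ) ?_ (fun a b => ?_) hx hy
  · have := (tfL z).continuous
    exact isClosed_eq (by fun_prop) (by fun_prop)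
  · simp only [gradL_apply, tfL_schwartz]
    rw [inner_posS, posS_tfS, toLp_add', toLp_smul', inner_add_left, inner_smul_left]
    simp only [map_mul, Complex.conj_I, Complex.conj_ofReal, map_ofNat]
    ring

lemma gradGraph_leibniz_der (z : ℝ × ℝ) {x y : L2R × L2R × L2R}
    (hx : x ∈ gradGraph) (hy : y ∈ gradGraph) :
    2 * Real.pi * Complex.I * z.2 * ⟪tfL z y.1, x.1⟫_ℂ =
      ⟪tfL z y.1, x.2.2⟫_ℂ + ⟪tfL z y.2.2, x.1⟫_ℂ := by
  refine gradGraph_induction (P := fun x y => 2 * Real.pi * Complex.I * z.2 * ⟪tfL z y.1, x.1⟫_ℂ =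
      ⟪tfL z y.1, x.2.2⟫_ℂ + ⟪tfL z y.2.2, x.1⟫_ℂ) ?_ (fun a b => ?_) hx hy
  · have := (tfL z).continuous
    exact isClosed_eq (by fun_prop) (by fun_prop)
  · simp only [gradL_apply, tfL_schwartz]
    rw [inner_derS, derS_tfS, toLp_add', toLp_smul', inner_add_left, inner_smul_left]
    simp only [map_mul, Complex.conj_I, Complex.conj_ofReal, map_ofNat]
    ring

/-- The curvature of the connection `(2πit, d/dt)` is constant. -/
lemma gradGraph_curvature {x y : L2R × L2R × L2R} (hx : x ∈ gradGraph) (hy : y ∈ gradGraph) :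
    ⟪y.2.1, x.2.2⟫_ℂ - ⟪y.2.2, x.2.1⟫_ℂ = 2 * Real.pi * Complex.I * ⟪y.1, x.1⟫_ℂ := by
  refine gradGraph_induction (P := fun x y => ⟪y.2.1, x.2.2⟫_ℂ - ⟪y.2.2, x.2.1⟫_ℂ =
      2 * Real.pi * Complex.I * ⟪y.1, x.1⟫_ℂ) ?_ (fun a b => ?_) hx hy
  · exact isClosed_eq (by fun_prop) (by fun_prop)
  · simp only [gradL_apply]
    have h1 := inner_posS b (derS a)
    have h2 := inner_derS b (posS a)
    rw [posS_derS, toLp_add', toLp_smul', inner_add_right, inner_smul_right] at h2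
    linear_combination h1 - h2

lemma norm_toLp_ne_zero {φ : 𝓢(ℝ, ℂ)} (hφ : φ ≠ 0) : φ.toLp 2 (volume : Measure ℝ) ≠ 0 := by
  intro h
  have h0 : (0 : 𝓢(ℝ, ℂ)).toLp 2 (volume : Measure ℝ) = 0 := rfl
  exact hφ (SchwartzMap.injective_toLp 2 volume (h.trans h0.symm))

lemma integrable_stft_mul (φ : 𝓢(ℝ, ℂ)) {g : L2R}
    (hg : Integrable fun z : ℝ × ℝ => ‖stft φ g z‖ * (1 + |z.1| + |z.2|)) {u : ℝ × ℝ → ℂ}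
    (hu : Continuous u) {C : ℝ} (hC : ∀ z, ‖u z‖ ≤ C * (1 + |z.1| + |z.2|)) :
    Integrable fun z : ℝ × ℝ => stft φ g z * u z := by
  have hc := continuous_stft φ g
  refine (hg.const_mul C).mono' (hc.mul hu).aestronglyMeasurable (ae_of_all _ fun z => ?_)
  calc _ = ‖stft φ g z‖ * ‖u z‖ := norm_mul _ _
    _ ≤ ‖stft φ g z‖ * (C * (1 + |z.1| + |z.2|)) := by gcongr; exact hC z
    _ = _ := by ring

lemma norm_two_pi_I_mul (x : ℝ) : ‖(2 * Real.pi * Complex.I * x : ℂ)‖ = 2 * Real.pi * |x| := by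
  simp [abs_of_pos Real.pi_pos]

lemma gradL_smul_tfS (c : ℂ) (z : ℝ × ℝ) (φ : 𝓢(ℝ, ℂ)) :
    gradL (c • tfS z φ) = (c • tfL z (φ.toLp 2 (volume : Measure ℝ)),
      c • tfL z ((posS φ).toLp 2 (volume : Measure ℝ)) + (c * (2 * Real.pi * Complex.I *
          z.1)) • tfL z (φ.toLp 2 (volume : Measure ℝ)),
      c • tfL z ((derS φ).toLp 2 (volume : Measure ℝ)) + (c * (2 * Real.pi * Complex.I *
          z.2)) • tfL z (φ.toLp 2 (volume : Measure ℝ))) := by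
  simp only [gradL_apply, map_smul, posS_tfS, derS_tfS, toLp_add', toLp_smul', tfL_schwartz]
  simp only [Prod.smul_mk, smul_add, smul_smul]

/-- The inclusion of a complete subspace is an isometry and commutes with the Bochner integral. No
integrability is needed, as the default value `0` also lies in the subspace. -/
lemma integral_gradL_mem {Ψ : ℝ × ℝ → 𝓢(ℝ, ℂ)} : ∫ z, gradL (Ψ z) ∈ gradGraph := by
  have : CompleteSpace gradGraph :=
    (Submodule.isClosed_topologicalClosure _).completeSpace_coe
  let Φ : ℝ × ℝ → gradGraph := fun z =>
    ⟨gradL (Ψ z), Submodule.le_topologicalClosure _ ⟨_, rfl⟩⟩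
  rw [show ∫ z, gradL (Ψ z) = gradGraph.subtypeₗᵢ (∫ z, Φ z) from
    gradGraph.subtypeₗᵢ.integral_comp_comm Φ]
  exact (∫ z, Φ z).2

/-- Both operators are applied under the integral of the inversion formula. On `tfS z φ` they cost
one factor `z.1` or `z.2`, so a first-order weight is enough. -/
lemma exists_gradGraph {φ : 𝓢(ℝ, ℂ)} (hφ : φ ≠ 0) {g : L2R}
    (hg : Integrable fun z : ℝ × ℝ => ‖stft φ g z‖ * (1 + |z.1| + |z.2|)) :
    ∃ g₁ g₂, (g, g₁, g₂) ∈ gradGraph := by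
  have h0 : Integrable (stft φ g) := by
    simpa using integrable_stft_mul φ hg (u := fun _ => 1) (C := 1) continuous_const
      fun z => by simp; linarith [abs_nonneg z.1, abs_nonneg z.2]
  have h1 : Integrable fun z : ℝ × ℝ => stft φ g z * (2 * Real.pi * Complex.I * z.1) := by
    refine integrable_stft_mul φ hg (C := 2 * Real.pi) (by fun_prop) fun z => ?_
    rw [norm_two_pi_I_mul]
    gcongr
    linarith [abs_nonneg z.2]
  have h2 : Integrable fun z : ℝ × ℝ => stft φ g z * (2 * Real.pi * Complex.I * z.2) := by
    refine integrable_stft_mul φ hg (C := 2 * Real.pi) (by fun_prop) fun z => ?_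
    rw [norm_two_pi_I_mul]
    gcongr
    linarith [abs_nonneg z.1]
  have key : ∀ {u : ℝ × ℝ → ℂ}, Integrable u → ∀ a : 𝓢(ℝ, ℂ),
      Integrable fun z => u z • tfL z (a.toLp 2 (volume : Measure ℝ)) := fun hu a =>
    hu.smul_bdd ‖a.toLp 2 (volume : Measure ℝ)‖ (continuous_tfL a).aestronglyMeasurable
      (ae_of_all _ fun z => ((tfL z).norm_map _).le)
  have hI : Integrable fun z => gradL (stft φ g z • tfS z φ) := by
    simp only [gradL_smul_tfS]
    exact (key h0 φ).prodMk (((key h0 _).add (key h1 φ)).prodMk ((key h0 _).add (key h2 φ)))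
  have h3 : (∫ z, gradL (stft φ g z • tfS z φ)).1 =
      ⟪φ.toLp 2 (volume : Measure ℝ), φ.toLp 2 (volume : Measure ℝ)⟫_ℂ • g := by
    rw [fst_integral hI, ← integral_stft_smul_tfL φ h0]
    simp only [gradL_smul_tfS]
  have h4 : ⟪φ.toLp 2 (volume : Measure ℝ), φ.toLp 2 (volume : Measure ℝ)⟫_ℂ ≠ 0 :=
    inner_self_ne_zero.2 (norm_toLp_ne_zero hφ)
  obtain ⟨Z, hZ, hZ1⟩ : ∃ Z ∈ gradGraph, Z.1 = g := by
    refine ⟨_, gradGraph.smul_mem (⟪φ.toLp 2 (volume : Measure ℝ), φ.toLp 2 (volume :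
        Measure ℝ)⟫_ℂ)⁻¹
      integral_gradL_mem, (?_ : _ • (∫ z, gradL (stft φ g z • tfS z φ)).1 = g)⟩
    rw [h3, smul_smul, inv_mul_cancel₀ h4, one_smul]
  refine ⟨Z.2.1, Z.2.2, ?_⟩
  rw [← hZ1]
  exact hZ

end Connection

/-! ### Weighted summability of matrix coefficients over a lattice -/

section Sampling

open scoped InnerProductSpace ENNReal

/-- The weight `(1 + |x| + |ω|)^s`. -/
def tfWeight (s : ℝ) (z : ℝ × ℝ) : ℝ := (1 + |z.1| + |z.2|) ^ s

lemma one_le_base (z : ℝ × ℝ) : 1 ≤ 1 + |z.1| + |z.2| := by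
  linarith [abs_nonneg z.1, abs_nonneg z.2]

lemma tfWeight_nonneg (s : ℝ) (z : ℝ × ℝ) : 0 ≤ tfWeight s z :=
  Real.rpow_nonneg (zero_le_one.trans (one_le_base z)) s

lemma one_le_tfWeight {s : ℝ} (hs : 0 ≤ s) (z : ℝ × ℝ) : 1 ≤ tfWeight s z :=
  Real.one_le_rpow (one_le_base z) hs

lemma continuous_tfWeight (s : ℝ) : Continuous (tfWeight s) := by
  unfold tfWeight
  refine Continuous.rpow_const (by fun_prop) fun z => Or.inl ?_
  linarith [one_le_base z]

lemma tfWeight_add_le {s : ℝ} (hs : 0 ≤ s) (z w : ℝ × ℝ) :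
    tfWeight s (z + w) ≤ tfWeight s z * tfWeight s w := by
  unfold tfWeight
  rw [← Real.mul_rpow (by linarith [one_le_base z]) (by linarith [one_le_base w])]
  refine Real.rpow_le_rpow (by linarith [one_le_base (z + w)]) ?_ hs
  have h1 := abs_add_le z.1 w.1
  have h2 := abs_add_le z.2 w.2
  have h3 : 0 ≤ (|z.1| + |z.2|) * (|w.1| + |w.2|) := by positivity
  simp only [Prod.fst_add, Prod.snd_add]
  nlinarith

lemma tfWeight_neg (s : ℝ) (z : ℝ × ℝ) : tfWeight s (-z) = tfWeight s z := by
  simp [tfWeight]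

lemma norm_inner_tfL_tfL (z w : ℝ × ℝ) (f g : L2R) :
    ‖⟪tfL z f, tfL w g⟫_ℂ‖ = ‖⟪tfL (z - w) f, g⟫_ℂ‖ := by
  have h := tfL_tfL w (z - w) f
  rw [add_sub_cancel] at h
  have h2 : ‖⟪tfL w (tfL (z - w) f), tfL w g⟫_ℂ‖ = ‖⟪tfL z f, tfL w g⟫_ℂ‖ := by
    rw [h, inner_smul_left, norm_mul, RCLike.norm_conj, Complex.norm_exp]
    simp
  rw [← h2, LinearIsometry.inner_map_map]

lemma exists_tsum_shift_le {α : ℝ} (hα : α ≠ 0) :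
    ∃ M : ℝ≥0∞, M ≠ ∞ ∧ ∀ x : ℝ,
      ∑' n : ℤ, ENNReal.ofReal (((1 + |x - α * n|) ^ 2)⁻¹) ≤ M := by
  have hs : Summable fun n : ℤ => ((1 + |α * n|) ^ 2)⁻¹ := by
    have h1 : Summable fun n : ℤ => (α ^ 2)⁻¹ * (1 / (n : ℝ) ^ 2) :=
      (Real.summable_one_div_int_pow.2 one_lt_two).mul_left _
    refine Summable.of_norm_bounded_eventually h1 ?_
    have : ∀ᶠ n : ℤ in cofinite, n ≠ 0 := by
      rw [eventually_cofinite]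
      simp
    filter_upwards [this] with n hn
    have hn' : 0 < |α * n| := abs_pos.2 (mul_ne_zero hα (by exact_mod_cast hn))
    rw [Real.norm_of_nonneg (by positivity), one_div, ← mul_inv, ← mul_pow, ← sq_abs (α * n)]
    gcongr
    linarith
  refine ⟨ENNReal.ofReal ((1 + |α|) ^ 2) * ENNReal.ofReal (∑' n : ℤ, ((1 + |α * n|) ^ 2)⁻¹),
    ENNReal.mul_ne_top ENNReal.ofReal_ne_top ENNReal.ofReal_ne_top, fun x => ?_⟩
  -- Shifting `n` by the integer nearest to `x / α` reduces `x` to some `y` with `|y| ≤ |α|`, which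
  -- makes the bound uniform in `x`.
  rw [ENNReal.ofReal_tsum_of_nonneg (fun n => by positivity) hs, ← ENNReal.tsum_mul_left,
    ← (Equiv.addRight (round (x / α))).tsum_eq]
  refine ENNReal.tsum_le_tsum fun n => ?_
  rw [← ENNReal.ofReal_mul (by positivity)]
  refine ENNReal.ofReal_le_ofReal ?_
  rw [← div_eq_mul_inv, le_div_iff₀ (by positivity), inv_mul_le_iff₀ (by positivity), ← mul_pow]
  gcongr
  set y : ℝ := x - α * round (x / α) with hy
  have hy1 : |y| ≤ |α| := by
    have h1 : y = α * (x / α - round (x / α)) := by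
      rw [hy, mul_sub, mul_div_cancel₀ _ hα]
    rw [h1, abs_mul]
    have h2 := abs_sub_round (x / α)
    exact mul_le_of_le_one_right (abs_nonneg _) (by linarith)
  have hy2 : x - α * ((Equiv.addRight (round (x / α)) n : ℤ) : ℝ) = y - α * n := by
    simp only [Equiv.coe_addRight, Int.cast_add, hy]
    ring
  rw [hy2]
  have h3 : |α * n| ≤ |y - α * n| + |y| := by
    have := abs_sub_abs_le_abs_sub (α * n) y
    rw [abs_sub_comm (α * n) y] at this
    linarith
  nlinarith [abs_nonneg (y - α * n), abs_nonneg y, mul_nonneg (abs_nonneg (y - α * n))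
      (abs_nonneg α)]

/-- The exponent `s + 4` pays for the weight and for an inverse square in each variable. -/
lemma mul_tfWeight_le {s C : ℝ} {N : ℕ} (hN : s + 4 ≤ N) {K : ℝ} (hK : 0 ≤ K) (z : ℝ × ℝ)
    (hd : (1 + |z.1| + |z.2|) ^ N * K ≤ C) :
    K * tfWeight s z ≤ C * (((1 + |z.1|) ^ 2)⁻¹ * ((1 + |z.2|) ^ 2)⁻¹) := by
  have hb := one_le_base z
  have hb0 : 0 < 1 + |z.1| + |z.2| := by linarith
  have h1 : 1 + |z.1| ≤ 1 + |z.1| + |z.2| := by linarith [abs_nonneg z.2]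
  have h2 : 1 + |z.2| ≤ 1 + |z.1| + |z.2| := by linarith [abs_nonneg z.1]
  have h3 : tfWeight s z * ((1 + |z.1|) ^ 2 * (1 + |z.2|) ^ 2) ≤ (1 + |z.1| + |z.2|) ^ N := by
    calc tfWeight s z * ((1 + |z.1|) ^ 2 * (1 + |z.2|) ^ 2)
        ≤ tfWeight s z * ((1 + |z.1| + |z.2|) ^ 2 * (1 + |z.1| + |z.2|) ^ 2) :=
          mul_le_mul_of_nonneg_left (mul_le_mul (pow_le_pow_left₀ (by positivity) h1 2)
            (pow_le_pow_left₀ (by positivity) h2 2) (by positivity) (by positivity))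
            (tfWeight_nonneg s z)
      _ = (1 + |z.1| + |z.2|) ^ (s + 4) := by
          rw [Real.rpow_add hb0, tfWeight, ← pow_add]
          norm_num
      _ ≤ (1 + |z.1| + |z.2|) ^ (N : ℝ) := Real.rpow_le_rpow_of_exponent_le hb hN
      _ = _ := Real.rpow_natCast _ _
  rw [← mul_inv, ← div_eq_mul_inv, le_div_iff₀ (by positivity)]
  calc K * tfWeight s z * ((1 + |z.1|) ^ 2 * (1 + |z.2|) ^ 2)
      = (tfWeight s z * ((1 + |z.1|) ^ 2 * (1 + |z.2|) ^ 2)) * K := by ring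
    _ ≤ (1 + |z.1| + |z.2|) ^ N * K := mul_le_mul_of_nonneg_right h3 hK
    _ ≤ C := hd

lemma exists_tsum_weight_le {K : ℝ × ℝ → ℝ} (hK : ∀ z, 0 ≤ K z)
    (hd : ∀ N : ℕ, ∃ C, 0 ≤ C ∧ ∀ z : ℝ × ℝ, (1 + |z.1| + |z.2|) ^ N * K z ≤ C) (s : ℝ)
    {α β : ℝ} (hα : α ≠ 0) (hβ : β ≠ 0) :
    ∃ M : ℝ≥0∞, M ≠ ∞ ∧ ∀ z : ℝ × ℝ, ∑' n : ℤ × ℤ,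
      ENNReal.ofReal (K (z - (α * n.1, β * n.2)) * tfWeight s (z - (α * n.1, β * n.2))) ≤ M := by
  obtain ⟨N, hN⟩ := exists_nat_ge (s + 4)
  obtain ⟨C, hC, hd⟩ := hd N
  obtain ⟨M₁, hM₁, h₁⟩ := exists_tsum_shift_le hα
  obtain ⟨M₂, hM₂, h₂⟩ := exists_tsum_shift_le hβ
  refine ⟨ENNReal.ofReal C * (M₁ * M₂), ENNReal.mul_ne_top ENNReal.ofReal_ne_top
    (ENNReal.mul_ne_top hM₁ hM₂), fun z => ?_⟩
  calc _ ≤ ∑' n : ℤ × ℤ, ENNReal.ofReal C * (ENNReal.ofReal (((1 + |z.1 - α * n.1|) ^ 2)⁻¹) *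
        ENNReal.ofReal (((1 + |z.2 - β * n.2|) ^ 2)⁻¹)) := by
        refine ENNReal.tsum_le_tsum fun n => ?_
        rw [← ENNReal.ofReal_mul (by positivity), ← ENNReal.ofReal_mul hC]
        exact ENNReal.ofReal_le_ofReal (mul_tfWeight_le hN (hK _) _ (hd _))
    _ = ENNReal.ofReal C * ((∑' n : ℤ, ENNReal.ofReal (((1 + |z.1 - α * n|) ^ 2)⁻¹)) *
        ∑' n : ℤ, ENNReal.ofReal (((1 + |z.2 - β * n|) ^ 2)⁻¹)) := by
        rw [ENNReal.tsum_mul_left, ENNReal.tsum_prod']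
        simp only [ENNReal.tsum_mul_left, ENNReal.tsum_mul_right]
    _ ≤ _ := mul_le_mul_right (mul_le_mul' (h₁ _) (h₂ _)) _

/-- Tonelli brings the lattice sum inside, where the kernel sum is bounded uniformly in the base
point. -/
lemma tsum_lintegral_le {ι : Type*} [Countable ι] {G H κ : ℝ × ℝ → ℝ≥0∞} (hG : Measurable G)
    (hH : Measurable H) (hκ : Measurable κ) (v : ι → ℝ × ℝ) {M : ℝ≥0∞}
    (hM : ∀ z, ∑' n, κ (z - v n) ≤ M) :
    ∑' n, ∫⁻ z, ∫⁻ w, G z * H w * κ (z - w - v n) ≤ (∫⁻ z, G z) * (∫⁻ w, H w) * M := by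
  have hm1 : ∀ n, Measurable fun p : (ℝ × ℝ) × (ℝ × ℝ) =>
      G p.1 * H p.2 * κ (p.1 - p.2 - v n) := fun n => by fun_prop
  calc _ = ∫⁻ z, ∫⁻ w, ∑' n, G z * H w * κ (z - w - v n) := by
        rw [← lintegral_tsum fun n => ((hm1 n).lintegral_prod_right').aemeasurable]
        congr 1
        funext z
        exact (lintegral_tsum fun n => ((hm1 n).comp measurable_prodMk_left).aemeasurable).symm
    _ ≤ ∫⁻ z, ∫⁻ w, G z * H w * M := by
        gcongr with z w
        rw [ENNReal.tsum_mul_left]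
        gcongr
        exact hM _
    _ = _ := by
        simp only [mul_assoc]
        rw [← lintegral_mul_const _ hG]
        congr 1
        funext z
        rw [lintegral_const_mul _ (hH.mul_const M), lintegral_mul_const _ hH]

lemma ofReal_tfWeight_le {s : ℝ} (hs : 0 ≤ s) (z w v : ℝ × ℝ) :
    ENNReal.ofReal (tfWeight s v) ≤ ENNReal.ofReal (tfWeight s z) * ENNReal.ofReal (tfWeight s w) *
      ENNReal.ofReal (tfWeight s (z - w - v)) := by
  rw [← ENNReal.ofReal_mul (tfWeight_nonneg _ _),
    ← ENNReal.ofReal_mul (mul_nonneg (tfWeight_nonneg _ _) (tfWeight_nonneg _ _))]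
  refine ENNReal.ofReal_le_ofReal ?_
  have e : v = z + -w + -(z - w - v) := by abel
  have h6 := tfWeight_add_le hs (z + -w) (-(z - w - v))
  have h7 := tfWeight_add_le hs z (-w)
  rw [← e, tfWeight_neg] at h6
  rw [tfWeight_neg] at h7
  exact h6.trans (mul_le_mul_of_nonneg_right h7 (tfWeight_nonneg _ _))

lemma enorm_mul_enorm_inner_le (φ : 𝓢(ℝ, ℂ)) {g : L2R} (hg : Integrable (stft φ g)) (f : L2R)
    {c : ℝ≥0∞} (hc : c = ‖⟪φ.toLp 2 (volume : Measure ℝ), φ.toLp 2 (volume : Measure ℝ)⟫_ℂ‖ₑ) :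
    c * ‖⟪f, g⟫_ℂ‖ₑ ≤ ∫⁻ z, ‖stft φ g z‖ₑ * ‖⟪f, tfL z (φ.toLp 2 (volume : Measure ℝ))⟫_ℂ‖ₑ := by
  rw [hc, ← enorm_mul, ← inner_smul_right, ← integral_stft_smul_tfL φ hg,
    ← integral_inner (integrable_stft_smul_tfL φ hg)]
  refine (enorm_integral_le_lintegral_enorm _).trans_eq ?_
  simp only [inner_smul_right, enorm_mul]

lemma enorm_inner_tfL_tfL (z w : ℝ × ℝ) (f g : L2R) :
    ‖⟪tfL z f, tfL w g⟫_ℂ‖ₑ = ‖⟪tfL (z - w) f, g⟫_ℂ‖ₑ := by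
  rw [← enorm_norm, norm_inner_tfL_tfL, enorm_norm]

lemma enorm_inner_symm (f g : L2R) : ‖⟪f, g⟫_ℂ‖ₑ = ‖⟪g, f⟫_ℂ‖ₑ := by
  rw [← enorm_norm, norm_inner_symm, enorm_norm]

/-- The reproducing formula bounds the matrix coefficients of a time-frequency shift. -/
lemma enorm_inner_tfL_le (φ : 𝓢(ℝ, ℂ)) {g h : L2R} (hg : Integrable (stft φ g))
    (hh : Integrable (stft φ h)) (v : ℝ × ℝ)
    {c : ℝ≥0∞} (hcφ : c = ‖⟪φ.toLp 2 (volume : Measure ℝ), φ.toLp 2 (volume : Measure ℝ)⟫_ℂ‖ₑ) :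
    c ^ 2 * ‖⟪tfL v h, g⟫_ℂ‖ₑ ≤
      ∫⁻ z, ∫⁻ w, ‖stft φ g z‖ₑ * ‖stft φ h w‖ₑ * ‖stft φ (φ.toLp 2 (volume : Measure ℝ))
          (z - w - v)‖ₑ := by
  have h1 := enorm_mul_enorm_inner_le φ hg (tfL v h) hcφ
  have h2 := fun z => enorm_mul_enorm_inner_le φ hh (tfL (z - v) (φ.toLp 2 (volume :
      Measure ℝ))) hcφ
  have hc : c ≠ ∞ := by
    rw [hcφ]
    exact enorm_ne_top
  have h3 : ∀ z, ‖⟪tfL v h, tfL z (φ.toLp 2 (volume : Measure ℝ))⟫_ℂ‖ₑ = ‖⟪tfL (z - v)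
      (φ.toLp 2 (volume : Measure ℝ)), h⟫_ℂ‖ₑ :=
    fun z => (enorm_inner_symm _ _).trans (enorm_inner_tfL_tfL _ _ _ _)
  have h4 : ∀ z w, ‖⟪tfL (z - v) (φ.toLp 2 (volume : Measure ℝ)), tfL w (φ.toLp 2 (volume :
      Measure ℝ))⟫_ℂ‖ₑ =
      ‖stft φ (φ.toLp 2 (volume : Measure ℝ)) (z - w - v)‖ₑ := fun z w => by
    rw [sub_right_comm z w v]
    exact enorm_inner_tfL_tfL _ _ _ _
  calc c ^ 2 * ‖⟪tfL v h, g⟫_ℂ‖ₑ = c * (c * ‖⟪tfL v h, g⟫_ℂ‖ₑ) := by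
        rw [sq, mul_assoc]
    _ ≤ c * ∫⁻ z, ‖stft φ g z‖ₑ * ‖⟪tfL v h, tfL z (φ.toLp 2 (volume : Measure ℝ))⟫_ℂ‖ₑ :=
        mul_le_mul_right h1 c
    _ = ∫⁻ z, ‖stft φ g z‖ₑ * (c * ‖⟪tfL (z - v) (φ.toLp 2 (volume : Measure ℝ)), h⟫_ℂ‖ₑ) := by
        rw [← lintegral_const_mul' _ _ hc]
        refine lintegral_congr fun z => ?_
        rw [h3 z, mul_left_comm]
    _ ≤ ∫⁻ z, ‖stft φ g z‖ₑ * ∫⁻ w, ‖stft φ h w‖ₑ * ‖stft φ (φ.toLp 2 (volume : Measure ℝ))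
        (z - w - v)‖ₑ := by
        refine lintegral_mono fun z => mul_le_mul_right ((h2 z).trans_eq ?_) _
        refine lintegral_congr fun w => ?_
        rw [h4 z w]
    _ = _ := by
        refine lintegral_congr fun z => ?_
        rw [← lintegral_const_mul' _ _ enorm_ne_top]
        simp only [mul_assoc]

/-- For windows in `M¹_s(ℝ)` the matrix coefficients over a lattice are in `ℓ¹_s`. -/
lemma summable_inner_tfL {φ : 𝓢(ℝ, ℂ)} (hφ : φ ≠ 0) {s : ℝ} (hs : 0 ≤ s) {g h : L2R}
    (hg : Integrable fun z : ℝ × ℝ => ‖stft φ g z‖ * tfWeight s z)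
    (hh : Integrable fun z : ℝ × ℝ => ‖stft φ h z‖ * tfWeight s z)
    {α β : ℝ} (hα : α ≠ 0) (hβ : β ≠ 0) :
    Summable fun n : ℤ × ℤ =>
      ‖⟪tfL (α * n.1, β * n.2) h, g⟫_ℂ‖ * tfWeight s (α * n.1, β * n.2) := by
  obtain ⟨M, hM, hMb⟩ := exists_tsum_weight_le
    (K := fun z => ‖stft φ (φ.toLp 2 (volume : Measure ℝ)) z‖) (fun z => norm_nonneg _)
        (exists_stft_decay φ φ) s hα hβ
  have hint : ∀ {f : L2R}, (Integrable fun z : ℝ × ℝ => ‖stft φ f z‖ * tfWeight s z) →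
      Integrable (stft φ f) := fun {f} hf => by
    refine hf.mono' (continuous_stft φ f).aestronglyMeasurable (ae_of_all _ fun z => ?_)
    exact le_mul_of_one_le_right (norm_nonneg _) (one_le_tfWeight hs z)
  obtain ⟨c, hcφ⟩ : ∃ c, c = ‖⟪φ.toLp 2 (volume : Measure ℝ), φ.toLp 2 (volume : Measure ℝ)⟫_ℂ‖ₑ :=
      ⟨_, rfl⟩
  have hmain := fun v => enorm_inner_tfL_le φ (hint hg) (hint hh) v hcφ
  have hc0 : c ≠ 0 := by
    rw [hcφ, enorm_ne_zero]
    exact inner_self_ne_zero.2 (norm_toLp_ne_zero hφ)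
  clear hcφ
  have hGe : ∀ f z, ‖stft φ f z‖ₑ * ENNReal.ofReal (tfWeight s z) =
      ‖‖stft φ f z‖ * tfWeight s z‖ₑ := fun f z => by
    rw [enorm_mul, enorm_norm, Real.enorm_of_nonneg (tfWeight_nonneg s z)]
  have hGm : ∀ f, Measurable fun z => ‖stft φ f z‖ₑ * ENNReal.ofReal (tfWeight s z) := fun f => by
    have h1 := (continuous_stft φ f).measurable
    have h2 := (continuous_tfWeight s).measurable
    fun_prop
  have hG : ∀ {f : L2R}, (Integrable fun z : ℝ × ℝ => ‖stft φ f z‖ * tfWeight s z) →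
      ∫⁻ z, ‖stft φ f z‖ₑ * ENNReal.ofReal (tfWeight s z) ≠ ∞ := fun {f} hf => by
    simp only [hGe]
    exact hf.2.ne
  simp only [ENNReal.ofReal_mul (norm_nonneg _), ofReal_norm] at hMb
  have htot := tsum_lintegral_le (hGm g) (hGm h) (hGm (φ.toLp 2 (volume : Measure ℝ)))
    (fun n : ℤ × ℤ => (α * n.1, β * n.2)) hMb
  -- Submultiplicativity shares the weight at `v = z - w - (z - w - v)` among the three factors.
  have hterm : ∀ v : ℝ × ℝ, c ^ 2 * ENNReal.ofReal (‖⟪tfL v h, g⟫_ℂ‖ * tfWeight s v) ≤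
      ∫⁻ z, ∫⁻ w, ‖stft φ g z‖ₑ * ENNReal.ofReal (tfWeight s z) *
        (‖stft φ h w‖ₑ * ENNReal.ofReal (tfWeight s w)) *
        (‖stft φ (φ.toLp 2 (volume : Measure ℝ)) (z - w - v)‖ₑ *
            ENNReal.ofReal (tfWeight s (z - w - v))) := by
    intro v
    rw [ENNReal.ofReal_mul (norm_nonneg _), ofReal_norm, ← mul_assoc]
    refine (mul_le_mul_left (hmain v) _).trans ?_
    rw [← lintegral_mul_const' _ _ ENNReal.ofReal_ne_top]
    refine lintegral_mono fun z => ?_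
    rw [← lintegral_mul_const' _ _ ENNReal.ofReal_ne_top]
    refine lintegral_mono fun w => ?_
    refine (mul_le_mul_right (ofReal_tfWeight_le hs z w v) _).trans_eq ?_
    ring
  have hfin : ∑' n : ℤ × ℤ, ENNReal.ofReal
      (‖⟪tfL (α * n.1, β * n.2) h, g⟫_ℂ‖ * tfWeight s (α * n.1, β * n.2)) ≠ ∞ := by
    intro htop
    have h9 := (ENNReal.tsum_le_tsum fun n : ℤ × ℤ => hterm (α * n.1, β * n.2)).trans htot
    rw [ENNReal.tsum_mul_left, htop, ENNReal.mul_top (pow_ne_zero 2 hc0), top_le_iff] at h9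
    exact ENNReal.mul_ne_top (ENNReal.mul_ne_top (hG hg) (hG hh)) hM h9
  refine (ENNReal.summable_toReal hfin).congr fun n => ?_
  rw [ENNReal.toReal_ofReal (mul_nonneg (norm_nonneg _) (tfWeight_nonneg _ _))]

end Sampling

/-! ### Bessel families and extension of weak expansions -/

section Bessel

open scoped InnerProductSpace

variable {L H : Type*} [NormedAddCommGroup H] [InnerProductSpace ℂ H]

/-- The Bessel condition on a family of vectors. -/
def IsBessel (e : L → H) : Prop :=
  ∃ B : ℝ, 0 ≤ B ∧ ∀ x, (Summable fun ν => ‖⟪e ν, x⟫_ℂ‖ ^ 2) ∧ ∑' ν, ‖⟪e ν, x⟫_ℂ‖ ^ 2 ≤ B * ‖x‖ ^ 2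

lemma IsBessel.exists_analysis {e : L → H} (he : IsBessel e) :
    ∃ C : H →L[ℂ] lp (fun _ : L => ℂ) 2, ∀ x ν, C x ν = ⟪e ν, x⟫_ℂ := by
  obtain ⟨B, hB, h⟩ := he
  have hmem : ∀ x, Memℓp (fun ν => ⟪e ν, x⟫_ℂ) 2 := fun x => by
    refine memℓp_gen ?_
    simpa using (h x).1
  let C₀ : H →ₗ[ℂ] lp (fun _ : L => ℂ) 2 :=
    { toFun := fun x => ⟨fun ν => ⟪e ν, x⟫_ℂ, hmem x⟩
      map_add' := fun x y => by ext ν; exact inner_add_right _ _ _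
      map_smul' := fun c x => by ext ν; exact inner_smul_right _ _ _ }
  refine ⟨C₀.mkContinuous (√B) fun x => ?_, fun x ν => rfl⟩
  have h1 : ‖C₀ x‖ ^ 2 = ∑' ν, ‖⟪e ν, x⟫_ℂ‖ ^ 2 := by
    have := lp.norm_rpow_eq_tsum (p := 2) (by simp) (C₀ x)
    simp only [ENNReal.toReal_ofNat, Real.rpow_ofNat] at this
    exact this
  refine le_of_sq_le_sq ?_ (by positivity)
  rw [h1, mul_pow, Real.sq_sqrt hB]
  exact (h x).2

/-- A weak frame expansion extends from a dense set to the whole Hilbert space. -/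
lemma IsBessel.expansion {e k : L → H} (he : IsBessel e) (hk : IsBessel k) {D : Set H}
    (hD : Dense D) (hexp : ∀ x ∈ D, ∀ v, HasSum (fun ν => ⟪e ν, x⟫_ℂ * ⟪v, k ν⟫_ℂ) ⟪v, x⟫_ℂ)
    (x v : H) : HasSum (fun ν => ⟪e ν, x⟫_ℂ * ⟪v, k ν⟫_ℂ) ⟪v, x⟫_ℂ := by
  obtain ⟨C, hC⟩ := he.exists_analysis
  obtain ⟨K, hK⟩ := hk.exists_analysis
  have h1 : ∀ x, HasSum (fun ν => ⟪e ν, x⟫_ℂ * ⟪v, k ν⟫_ℂ) ⟪K v, C x⟫_ℂ := fun x => by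
    refine (lp.hasSum_inner (K v) (C x)).congr_fun fun ν => ?_
    rw [hC, hK, RCLike.inner_apply, inner_conj_symm]
  -- Both sides are continuous in `x`, the left one because the Bessel bound makes the analysis
  -- operator bounded.
  have h2 : (fun x => ⟪K v, C x⟫_ℂ) = fun x => ⟪v, x⟫_ℂ := by
    refine Continuous.ext_on hD (by fun_prop) (by fun_prop) fun x hx => ?_
    exact (h1 x).unique (hexp x hx v)
  rw [← congrFun h2 x]
  exact h1 x

end Bessel

/-! ### The Hilbert space of the time domain and its time-frequency shifts -/

section TimeDomain

open scoped InnerProductSpace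

variable {q : ℕ} [NeZero q]

/-- The Hilbert space `L²(ℝ × ℤ_q)`, written as a direct sum of copies of `L²(ℝ)`. -/
abbrev L2T (q : ℕ) : Type := PiLp 2 fun _ : ZMod q => L2R

lemma norm_stdAddChar (j : ZMod q) : ‖(ZMod.stdAddChar j : ℂ)‖ = 1 := by
  rw [ZMod.stdAddChar_apply]
  exact Circle.norm_coe _

lemma conj_stdAddChar_mul (j : ZMod q) :
    conj (ZMod.stdAddChar j : ℂ) * ZMod.stdAddChar j = 1 := by
  rw [Complex.conj_mul', norm_stdAddChar]
  simp

/-- The time-frequency shift on `L²(ℝ × ℤ_q)`. -/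
def tfT (ν : Phase q) : L2T q →ₗᵢ[ℂ] L2T q where
  toFun F := WithLp.toLp 2 fun j =>
    (ZMod.stdAddChar (j * ν.2.2) : ℂ) • tfL (ν.1.1, ν.2.1) (F (j - ν.1.2))
  map_add' F G := by
    ext1 j
    simp
  map_smul' c F := by
    ext1 j
    simp [smul_comm c]
  norm_map' F := by
    simp only [LinearMap.coe_mk, AddHom.coe_mk, PiLp.norm_eq_of_L2, norm_smul, norm_stdAddChar,
      one_mul, LinearIsometry.norm_map]
    congr 1
    exact (Equiv.subRight ν.1.2).sum_comp fun j => ‖F j‖ ^ 2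

lemma tfT_apply (ν : Phase q) (F : L2T q) (j : ZMod q) :
    tfT ν F j = (ZMod.stdAddChar (j * ν.2.2) : ℂ) • tfL (ν.1.1, ν.2.1) (F (j - ν.1.2)) := rfl

lemma isProjRep_tfT : IsProjRep (cocycle (q := q)) (tfT (q := q)) where
  norm_cocycle μ ν := by
    rw [cocycle, norm_mul, norm_stdAddChar, Complex.norm_exp]
    simp
  map_zero F := by
    ext1 j
    rw [tfT_apply]
    simp only [Prod.fst_zero, Prod.snd_zero, mul_zero, sub_zero, AddChar.map_zero_eq_one, one_smul]
    exact tfL_zero (F j)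
  map_map μ ν F := by
    ext1 j
    rw [PiLp.smul_apply, tfT_apply, tfT_apply, tfT_apply, map_smul, tfL_tfL, cocycle, smul_smul,
      smul_smul, smul_smul]
    simp only [Prod.fst_add, Prod.snd_add, Prod.mk_add_mk, sub_sub]
    congr 1
    have h : (ZMod.stdAddChar (j * μ.2.2) : ℂ) * ZMod.stdAddChar ((j - μ.1.2) * ν.2.2) =
        ZMod.stdAddChar (-(μ.1.2 * ν.2.2)) * ZMod.stdAddChar (j * (μ.2.2 + ν.2.2)) := by
      rw [← AddChar.map_add_eq_mul, ← AddChar.map_add_eq_mul]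
      congr 1
      ring
    rw [h]
    ring

lemma timeMeasure_eq_sum :
    timeMeasure q = ∑ k : ZMod q, (volume : Measure ℝ).map fun x => (x, k) := by
  rw [timeMeasure, Measure.count, Measure.prod_sum_right, Measure.sum_fintype]
  simp only [Measure.prod_dirac]

lemma measurableEmbedding_prodMk (k : ZMod q) :
    MeasurableEmbedding fun x : ℝ => (x, k) :=
  measurableEmbedding_prod_mk_right k

lemma integral_timeMeasure {f : TimeDomain q → ℂ} (hf : ∀ k, Integrable fun x => f (x, k)) :
    ∫ z, f z ∂(timeMeasure q) = ∑ k, ∫ x, f (x, k) := by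
  rw [timeMeasure_eq_sum, integral_finsetSum_measure]
  · simp only [(measurableEmbedding_prodMk _).integral_map]
  · exact fun k _ => (measurableEmbedding_prodMk k).integrable_map_iff.2 (hf k)

lemma eLpNorm_slice_le (f : TimeDomain q → ℂ) (k : ZMod q) :
    eLpNorm (fun x => f (x, k)) 2 volume ≤ eLpNorm f 2 (timeMeasure q) := by
  have h := (measurableEmbedding_prodMk k).eLpNorm_map_measure (g := f) (p := 2)
    (μ := (volume : Measure ℝ))
  refine (le_of_eq h.symm).trans (eLpNorm_mono_measure f ?_)
  rw [timeMeasure_eq_sum, ← Measure.sum_fintype]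
  exact Measure.le_sum (fun k : ZMod q => (volume : Measure ℝ).map fun x => (x, k)) k

lemma memL2_of_slices {f : TimeDomain q → ℂ} (hf : ∀ k, MemLp (fun x => f (x, k)) 2) :
    MemL2 f := by
  have hm : AEStronglyMeasurable f (timeMeasure q) := by
    rw [timeMeasure_eq_sum, ← Measure.sum_fintype, aestronglyMeasurable_sum_measure_iff]
    exact fun k => (measurableEmbedding_prodMk k).aestronglyMeasurable_map_iff.2 (hf k).1
  rw [MemL2, memLp_two_iff_integrable_sq_norm hm, timeMeasure_eq_sum,
    integrable_finsetSum_measure]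
  exact fun k _ => (measurableEmbedding_prodMk k).integrable_map_iff.2
    ((memLp_two_iff_integrable_sq_norm (hf k).1).1 (hf k))

/-- The element of `L²(ℝ × ℤ_q)` given by a function. -/
def toL2T (f : TimeDomain q → ℂ) (hf : ∀ k, MemLp (fun x => f (x, k)) 2) : L2T q :=
  WithLp.toLp 2 fun k => (hf k).toLp

lemma toL2T_apply (f : TimeDomain q → ℂ) (hf : ∀ k, MemLp (fun x => f (x, k)) 2) (k : ZMod q) :
    toL2T f hf k = (hf k).toLp := rfl

lemma l2inner_eq_inner_toL2T {f g : TimeDomain q → ℂ} (hf : ∀ k, MemLp (fun x => f (x, k)) 2)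
    (hg : ∀ k, MemLp (fun x => g (x, k)) 2) :
    l2inner (timeMeasure q) f g = ⟪toL2T g hg, toL2T f hf⟫_ℂ := by
  rw [PiLp.inner_apply, l2inner, integral_timeMeasure]
  · refine Finset.sum_congr rfl fun k _ => ?_
    exact l2inner_eq_inner (hf k) (hg k)
  · intro k
    exact (hf k).integrable_mul (hg k).star

lemma integral_norm_sq_eq {f : TimeDomain q → ℂ} (hf : ∀ k, MemLp (fun x => f (x, k)) 2) :
    ∫ z, ‖f z‖ ^ 2 ∂(timeMeasure q) = ‖toL2T f hf‖ ^ 2 := by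
  have h := l2inner_eq_inner_toL2T hf hf
  rw [inner_self_eq_norm_sq_to_K, l2inner] at h
  have h2 : ∫ z, f z * conj (f z) ∂(timeMeasure q) =
      ((∫ z, ‖f z‖ ^ 2 ∂(timeMeasure q) : ℝ) : ℂ) := by
    refine Eq.trans ?_ (integral_ofReal (𝕜 := ℂ) (f := fun z => ‖f z‖ ^ 2))
    congr 1
    funext z
    rw [Complex.mul_conj']
    exact (Complex.ofReal_pow _ _).symm
  rw [h2] at h
  refine Complex.ofReal_injective (h.trans ?_)
  exact (Complex.ofReal_pow _ _).symm

lemma tfShift_slice (ν : Phase q) (f : TimeDomain q → ℂ) (k : ZMod q) :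
    (fun x => tfShift ν f (x, k)) = (ZMod.stdAddChar (k * ν.2.2) : ℂ) •
      tfShiftReal ν.1.1 ν.2.1 fun x => f (x, k - ν.1.2) := by
  funext x
  simp only [tfShift, tfShiftReal, Pi.smul_apply, smul_eq_mul]
  ring

lemma memLp_tfShift_slice (ν : Phase q) {f : TimeDomain q → ℂ}
    (hf : ∀ k, MemLp (fun x => f (x, k)) 2) (k : ZMod q) :
    MemLp (fun x => tfShift ν f (x, k)) 2 := by
  rw [tfShift_slice]
  exact (memLp_tfShiftReal (hf _) _ _).const_smul _

lemma toL2T_tfShift (ν : Phase q) {f : TimeDomain q → ℂ}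
    (hf : ∀ k, MemLp (fun x => f (x, k)) 2) :
    toL2T (tfShift ν f) (memLp_tfShift_slice ν hf) = tfT ν (toL2T f hf) := by
  ext1 k
  rw [tfT_apply, toL2T_apply, toL2T_apply, tfL_toLp, ← MemLp.toLp_const_smul]
  exact MemLp.toLp_congr _ _ (by rw [tfShift_slice])

lemma latticeInner_eq (L : AddSubgroup (Phase q)) {f g : TimeDomain q → ℂ}
    (hf : ∀ k, MemLp (fun x => f (x, k)) 2) (hg : ∀ k, MemLp (fun x => g (x, k)) 2) (ν : L) :
    latticeInner L f g ν = ⟪tfT (ν : Phase q) (toL2T g hg), toL2T f hf⟫_ℂ := by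
  rw [latticeInner, l2inner_eq_inner_toL2T hf (memLp_tfShift_slice _ hg), toL2T_tfShift]

lemma exists_toL2T (x : L2T q) :
    ∃ (f : TimeDomain q → ℂ) (hf : ∀ k, MemLp (fun x => f (x, k)) 2), toL2T f hf = x := by
  refine ⟨fun z => x z.2 z.1, fun k => Lp.memLp (x k), ?_⟩
  ext1 k
  exact Lp.toLp_coeFn (x k) (Lp.memLp (x k))

lemma IsGaborFrame.isBessel {L : AddSubgroup (Phase q)} {g : TimeDomain q → ℂ}
    (hg : ∀ k, MemLp (fun x => g (x, k)) 2) (h : IsGaborFrame L g) :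
    IsBessel fun ν : L => tfT (ν : Phase q) (toL2T g hg) := by
  obtain ⟨A, B, -, hB, h⟩ := h
  have key : ∀ x : L2T q, (Summable fun ν : L => ‖⟪tfT (ν : Phase q) (toL2T g hg), x⟫_ℂ‖ ^ 2) ∧
      ∑' ν : L, ‖⟪tfT (ν : Phase q) (toL2T g hg), x⟫_ℂ‖ ^ 2 ≤ B * ‖x‖ ^ 2 := by
    intro x
    obtain ⟨f, hf, rfl⟩ := exists_toL2T x
    obtain ⟨h1, -, h3⟩ := h f (memL2_of_slices hf)
    rw [integral_norm_sq_eq hf] at h3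
    simp only [latticeInner_eq L hf hg] at h1 h3
    exact ⟨h1, h3⟩
  exact ⟨B, hB.le, key⟩

lemma exists_toLp_sum {ι : Type*} {r : ι → ℝ → ℂ} (c : ι → ℂ) (hr : ∀ ν, MemLp (r ν) 2 volume)
    (F : Finset ι) : ∃ hm : MemLp (fun x => ∑ ν ∈ F, c ν * r ν x) 2 (volume : Measure ℝ),
      hm.toLp = ∑ ν ∈ F, c ν • (hr ν).toLp := by
  classical
  induction F using Finset.induction_on with
  | empty =>
    simp only [Finset.sum_empty]
    exact ⟨MemLp.zero, rfl⟩
  | insert a F ha ih =>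
    obtain ⟨hm, he⟩ := ih
    simp only [Finset.sum_insert ha]
    refine ⟨((hr a).const_mul (c a)).add hm, ?_⟩
    rw [← he, ← MemLp.toLp_const_smul, ← MemLp.toLp_add]
    rfl

lemma hasSum_toLp {ι : Type*} {f : ℝ → ℂ} {r : ι → ℝ → ℂ} {c : ι → ℂ}
    (hf : MemLp f 2 volume) (hr : ∀ ν, MemLp (r ν) 2 volume)
    (h : Tendsto (fun F : Finset ι => eLpNorm (fun x => f x - ∑ ν ∈ F, c ν * r ν x) 2 volume)
      atTop (𝓝 0)) : HasSum (fun ν => c ν • (hr ν).toLp) hf.toLp := by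
  rw [HasSum, tendsto_iff_norm_sub_tendsto_zero]
  have h1 := (ENNReal.tendsto_toReal ENNReal.zero_ne_top).comp h
  rw [ENNReal.toReal_zero] at h1
  refine h1.congr fun F => ?_
  obtain ⟨hm, he⟩ := exists_toLp_sum c hr F
  rw [← he, norm_sub_rev, ← MemLp.toLp_sub, Lp.norm_toLp]
  rfl

/-- Restriction to a slice does not increase the `L²` norm of the remainder. -/
lemma HasGaborExpansion.hasSum_slice {L : AddSubgroup (Phase q)} {f g h : TimeDomain q → ℂ}
    (hf : ∀ k, MemLp (fun x => f (x, k)) 2)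
    (hh : ∀ k, MemLp (fun x => h (x, k)) 2) (hexp : HasGaborExpansion L f g h) (k : ZMod q) :
    HasSum (fun ν : L => latticeInner L f g ν • tfT (ν : Phase q) (toL2T h hh) k)
      (toL2T f hf k) := by
  have h0 : Tendsto (fun F : Finset L => eLpNorm (fun x => f (x, k) - ∑ ν ∈ F,
      latticeInner L f g ν * tfShift (ν : Phase q) h (x, k)) 2 (volume : Measure ℝ)) atTop (𝓝 0) :=
    tendsto_of_tendsto_of_tendsto_of_le_of_le tendsto_const_nhds hexp (fun _ => zero_le)
      fun F => eLpNorm_slice_le (fun z => f z - ∑ ν ∈ F,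
        latticeInner L f g ν * tfShift (ν : Phase q) h z) k
  have h1 := hasSum_toLp (c := latticeInner L f g) (hf k)
    (fun ν : L => memLp_tfShift_slice (ν : Phase q) hh k) h0
  refine h1.congr_fun fun ν => ?_
  rw [← toL2T_tfShift]
  rfl

lemma HasGaborExpansion.hasSum_inner {L : AddSubgroup (Phase q)} {f g h : TimeDomain q → ℂ}
    (hf : ∀ k, MemLp (fun x => f (x, k)) 2) (hg : ∀ k, MemLp (fun x => g (x, k)) 2)
    (hh : ∀ k, MemLp (fun x => h (x, k)) 2) (hexp : HasGaborExpansion L f g h) (v : L2T q) :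
    HasSum (fun ν : L => ⟪tfT (ν : Phase q) (toL2T g hg), toL2T f hf⟫_ℂ *
      ⟪v, tfT (ν : Phase q) (toL2T h hh)⟫_ℂ) ⟪v, toL2T f hf⟫_ℂ := by
  simp only [PiLp.inner_apply v, Finset.mul_sum]
  refine hasSum_sum fun k _ => ?_
  have h2 := (hexp.hasSum_slice hf hh k).mapL (innerSL ℂ (v k))
  refine h2.congr_fun fun ν => ?_
  rw [innerSL_apply_apply, inner_smul_right, latticeInner_eq L hf hg]

end TimeDomain

/-! ### Schwartz functions in the modulation spaces -/

section Modulation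

open scoped InnerProductSpace

lemma MemM1Real.integrable {φ : 𝓢(ℝ, ℂ)} {s : ℝ} {f : ℝ → ℂ} (hf : MemM1Real φ s f) :
    Integrable fun z : ℝ × ℝ => ‖stft φ hf.1.toLp z‖ * tfWeight s z := by
  refine hf.2.congr (ae_of_all _ fun z => ?_)
  exact congrArg (fun c : ℂ => ‖c‖ * tfWeight s z)
    (l2inner_tfShiftReal hf.1 (φ.memLp 2 (volume : Measure ℝ)) z.1 z.2)

lemma integrable_stft_schwartz (φ a : 𝓢(ℝ, ℂ)) (s : ℝ) :
    Integrable fun z : ℝ × ℝ => ‖stft φ (a.toLp 2 (volume : Measure ℝ)) z‖ * tfWeight s z := by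
  obtain ⟨N, hN⟩ := exists_nat_ge (s + 4)
  obtain ⟨C, hC, hd⟩ := exists_stft_decay φ a N
  have h1 : Integrable fun x : ℝ => ((1 + |x|) ^ 2)⁻¹ := by
    refine (integrable_one_add_norm (E := ℝ) (μ := volume) (r := 2) (by simp)).congr
      (ae_of_all _ fun x => ?_)
    simp only [Real.norm_eq_abs]
    rw [Real.rpow_neg (by positivity), Real.rpow_ofNat]
  refine ((h1.mul_prod h1).const_mul C).mono' ?_ (ae_of_all _ fun z => ?_)
  · exact ((continuous_stft φ _).norm.mul (continuous_tfWeight s)).aestronglyMeasurable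
  · rw [Real.norm_of_nonneg (mul_nonneg (norm_nonneg _) (tfWeight_nonneg s z))]
    exact mul_tfWeight_le hN (norm_nonneg _) z (hd z)

lemma memM1Real_schwartz (φ a : 𝓢(ℝ, ℂ)) (s : ℝ) : MemM1Real φ s a := by
  refine ⟨a.memLp 2, (integrable_stft_schwartz φ a s).congr (ae_of_all _ fun z => ?_)⟩
  exact congrArg (fun c : ℂ => ‖c‖ * tfWeight s z) (l2inner_tfShiftReal
    (a.memLp 2 (volume : Measure ℝ)) (φ.memLp 2 (volume : Measure ℝ)) z.1 z.2).symm

end Modulation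

/-! ### The dual frame expansion for all square-integrable functions -/

section TimeDomain

open scoped InnerProductSpace

variable {q : ℕ} [NeZero q]

lemma memM1_schwartz (φ : 𝓢(ℝ, ℂ)) (s : ℝ) (a : ZMod q → 𝓢(ℝ, ℂ)) :
    MemM1 φ s fun z : TimeDomain q => a z.2 z.1 :=
  ⟨memL2_of_slices fun k => (a k).memLp 2, fun k => memM1Real_schwartz φ (a k) s⟩

lemma dense_range_schwartz : Dense (Set.range fun a : ZMod q → 𝓢(ℝ, ℂ) =>
    toL2T (fun z => a z.2 z.1) fun k => (a k).memLp 2 (volume : Measure ℝ)) := by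
  have h1 : DenseRange fun a : 𝓢(ℝ, ℂ) => a.toLp 2 (volume : Measure ℝ) :=
    SchwartzMap.denseRange_toLpCLM (p := 2) (by simp)
  have h2 : DenseRange (Pi.map fun _ : ZMod q => fun a : 𝓢(ℝ, ℂ) =>
      a.toLp 2 (volume : Measure ℝ)) := DenseRange.piMap fun _ => h1
  exact (WithLp.toLp_surjective (V := ZMod q → L2R) 2).denseRange.comp h2 (PiLp.continuous_toLp 2 _)

/-- The cocycle of the time-frequency shifts, restricted to a lattice. -/
def latticeCocycle (L : AddSubgroup (Phase q)) (μ ν : L) : ℂ := cocycle (μ : Phase q) (ν : Phase q)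

lemma isProjRep_lattice (L : AddSubgroup (Phase q)) :
    IsProjRep (latticeCocycle L) fun ν : L => tfT (ν : Phase q) where
  norm_cocycle _ _ := isProjRep_tfT.norm_cocycle _ _
  map_zero f := isProjRep_tfT.map_zero f
  map_map _ _ f := isProjRep_tfT.map_map _ _ f

lemma MemM1.memLp {φ : 𝓢(ℝ, ℂ)} {s : ℝ} {f : TimeDomain q → ℂ} (hf : MemM1 φ s f) (k : ZMod q) :
    MemLp (fun x => f (x, k)) 2 := (hf.2 k).1

/-- The expansion is assumed only on `M¹_s`, which contains the dense space of slicewise Schwartz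
functions; the upper frame bounds extend it weakly to all vectors. -/
lemma AreDualGaborFrames.expansion {φ : 𝓢(ℝ, ℂ)} {s : ℝ} {L : AddSubgroup (Phase q)}
    {g h : TimeDomain q → ℂ} (hg : MemM1 φ s g) (hh : MemM1 φ s h)
    (hd : AreDualGaborFrames φ s L g h) (f v : L2T q) :
    HasSum (fun ν : L => ⟪tfT (ν : Phase q) (toL2T g hg.memLp), f⟫_ℂ *
      ⟪v, tfT (ν : Phase q) (toL2T h hh.memLp)⟫_ℂ) ⟪v, f⟫_ℂ := by
  obtain ⟨h1, h2, h3⟩ := hd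
  refine (h1.isBessel hg.memLp).expansion (h2.isBessel hh.memLp) dense_range_schwartz ?_ f v
  rintro _ ⟨a, rfl⟩ v
  exact (h3 _ (memM1_schwartz φ s a)).hasSum_inner _ hg.memLp hh.memLp v

end TimeDomain

/-! ### Integer coordinates on the lattice -/

section Lattice

variable {q : ℕ} {α β : ℝ} {r t : ℕ}

/-- The point of the lattice with given integer coordinates. -/
def latticePoint (q : ℕ) (α β : ℝ) (r t : ℕ) (n : ℤ × ℤ) : lattice q α β r t :=
  ⟨((α * n.1, (n.1 * r : ZMod q)), (β * n.2, (n.2 * t : ZMod q))),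
    AddSubgroup.mem_prod.2 ⟨AddSubgroup.mem_zmultiples_iff.2 ⟨n.1, by simp [mul_comm]⟩,
      AddSubgroup.mem_zmultiples_iff.2 ⟨n.2, by simp [mul_comm]⟩⟩⟩

lemma bijective_latticePoint (hα : α ≠ 0) (hβ : β ≠ 0) :
    Function.Bijective (latticePoint q α β r t) := by
  constructor
  · intro m n h
    have h0 := congrArg Subtype.val h
    have h1 : α * (m.1 : ℝ) = α * n.1 := congrArg (fun z : Phase q => z.1.1) h0
    have h2 : β * (m.2 : ℝ) = β * n.2 := congrArg (fun z : Phase q => z.2.1) h0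
    exact Prod.ext (by exact_mod_cast mul_left_cancel₀ hα h1)
      (by exact_mod_cast mul_left_cancel₀ hβ h2)
  · rintro ⟨⟨x, y⟩, h⟩
    obtain ⟨⟨n, hn⟩, ⟨m, hm⟩⟩ := AddSubgroup.mem_prod.1 h
    refine ⟨(n, m), Subtype.ext ?_⟩
    change _ = (x, y)
    simp only at hn hm
    rw [← hn, ← hm]
    simp [latticePoint, mul_comm]

/-- Integer coordinates on the lattice. -/
def latticeEquiv (q : ℕ) (hα : α ≠ 0) (hβ : β ≠ 0) (r t : ℕ) : ℤ × ℤ ≃ lattice q α β r t :=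
  Equiv.ofBijective _ (bijective_latticePoint hα hβ)

end Lattice

/-! ### Weighted summability over the lattice in the time domain -/

section LatticeSums

open scoped InnerProductSpace

variable {q : ℕ} [NeZero q]

lemma inner_tfT (ν : Phase q) (x y : L2T q) :
    ⟪tfT ν y, x⟫_ℂ = ∑ j, conj (ZMod.stdAddChar (j * ν.2.2) : ℂ) *
      ⟪tfL (ν.1.1, ν.2.1) (y (j - ν.1.2)), x j⟫_ℂ := by
  rw [PiLp.inner_apply]
  refine Finset.sum_congr rfl fun j _ => ?_
  rw [tfT_apply, inner_smul_left]

/-- Summing over all pairs of slices makes the bound independent of the finite components of `ν`, so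
the real-line estimate applies. -/
lemma norm_inner_tfT_le (ν : Phase q) (x y : L2T q) :
    ‖⟪tfT ν y, x⟫_ℂ‖ ≤ ∑ j, ∑ k, ‖⟪tfL (ν.1.1, ν.2.1) (y k), x j⟫_ℂ‖ := by
  rw [inner_tfT]
  refine (norm_sum_le _ _).trans (Finset.sum_le_sum fun j _ => ?_)
  rw [norm_mul, RCLike.norm_conj, norm_stdAddChar, one_mul]
  exact Finset.single_le_sum (f := fun k => ‖⟪tfL (ν.1.1, ν.2.1) (y k), x j⟫_ℂ‖)
    (fun _ _ => norm_nonneg _) (Finset.mem_univ _)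

variable {φ : 𝓢(ℝ, ℂ)} {s α β : ℝ} {r t : ℕ}

lemma summable_inner_tfT (hφ : φ ≠ 0) (hs : 0 ≤ s) (hα : α ≠ 0) (hβ : β ≠ 0) {x y : L2T q}
    (hx : ∀ k, Integrable fun z : ℝ × ℝ => ‖stft φ (x k) z‖ * tfWeight s z)
    (hy : ∀ k, Integrable fun z : ℝ × ℝ => ‖stft φ (y k) z‖ * tfWeight s z) :
    Summable fun ν : lattice q α β r t =>
      ‖⟪tfT (ν : Phase q) y, x⟫_ℂ‖ * (1 + |ν.1.1.1| + |ν.1.2.1|) ^ s := by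
  rw [← (latticeEquiv q hα hβ r t).summable_iff]
  have h1 : Summable fun n : ℤ × ℤ => ∑ j, ∑ k,
      ‖⟪tfL (α * n.1, β * n.2) (y k), x j⟫_ℂ‖ * tfWeight s (α * n.1, β * n.2) :=
    summable_sum fun j _ => summable_sum fun k _ => summable_inner_tfL hφ hs (hx j) (hy k) hα hβ
  refine h1.of_nonneg_of_le (fun n => ?_) fun n => ?_
  · exact mul_nonneg (norm_nonneg _) (tfWeight_nonneg s (α * n.1, β * n.2))
  · simp only [← Finset.sum_mul]
    exact mul_le_mul_of_nonneg_right
      (norm_inner_tfT_le (latticePoint q α β r t n : Phase q) x y) (tfWeight_nonneg s (α * n.1, β *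
          n.2))

lemma summable_of_weight (hs : 0 ≤ s) {L : AddSubgroup (Phase q)} {a : L → ℂ}
    (ha : Summable fun ν : L => ‖a ν‖ * (1 + |ν.1.1.1| + |ν.1.2.1|) ^ s) :
    Summable fun ν : L => ‖a ν‖ :=
  ha.of_nonneg_of_le (fun _ => norm_nonneg _) fun ν =>
    le_mul_of_one_le_right (norm_nonneg _) (one_le_tfWeight hs (ν.1.1.1, ν.1.2.1))

lemma summable_mul_of_weight (hs : 1 ≤ s) {L : AddSubgroup (Phase q)} {a : L → ℂ}
    (ha : Summable fun ν : L => ‖a ν‖ * (1 + |ν.1.1.1| + |ν.1.2.1|) ^ s) {u : L → ℝ}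
    (hu : ∀ ν, |u ν| ≤ 1 + |ν.1.1.1| + |ν.1.2.1|) :
    Summable fun ν : L => ‖2 * Real.pi * Complex.I * (u ν : ℂ) * a ν‖ := by
  refine (ha.mul_left (2 * Real.pi)).of_nonneg_of_le (fun _ => norm_nonneg _) fun ν => ?_
  rw [norm_mul, norm_two_pi_I_mul]
  have h1 : |u ν| ≤ (1 + |ν.1.1.1| + |ν.1.2.1|) ^ s :=
    (hu ν).trans (Real.self_le_rpow_of_one_le (one_le_base (ν.1.1.1, ν.1.2.1)) hs)
  calc 2 * Real.pi * |u ν| * ‖a ν‖ = 2 * Real.pi * (‖a ν‖ * |u ν|) := by ring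
    _ ≤ _ := by gcongr

end LatticeSums

/-! ### The connection, slice by slice -/

section Gradient

open scoped InnerProductSpace

variable {q : ℕ} [NeZero q]

lemma leibniz_tfT_pos (ν : Phase q) {x x₁ x₂ y y₁ y₂ : L2T q}
    (hx : ∀ k, (x k, x₁ k, x₂ k) ∈ gradGraph) (hy : ∀ k, (y k, y₁ k, y₂ k) ∈ gradGraph) :
    2 * Real.pi * Complex.I * (ν.1.1 : ℂ) * ⟪tfT ν y, x⟫_ℂ = ⟪tfT ν y, x₁⟫_ℂ + ⟪tfT ν y₁, x⟫_ℂ := by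
  rw [inner_tfT, inner_tfT, inner_tfT, Finset.mul_sum, ← Finset.sum_add_distrib]
  refine Finset.sum_congr rfl fun j _ => ?_
  have h := gradGraph_leibniz_pos (ν.1.1, ν.2.1) (hx j) (hy (j - ν.1.2))
  linear_combination conj (ZMod.stdAddChar (j * ν.2.2) : ℂ) * h

lemma leibniz_tfT_der (ν : Phase q) {x x₁ x₂ y y₁ y₂ : L2T q}
    (hx : ∀ k, (x k, x₁ k, x₂ k) ∈ gradGraph) (hy : ∀ k, (y k, y₁ k, y₂ k) ∈ gradGraph) :
    2 * Real.pi * Complex.I * (ν.2.1 : ℂ) * ⟪tfT ν y, x⟫_ℂ = ⟪tfT ν y, x₂⟫_ℂ + ⟪tfT ν y₂, x⟫_ℂ := by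
  rw [inner_tfT, inner_tfT, inner_tfT, Finset.mul_sum, ← Finset.sum_add_distrib]
  refine Finset.sum_congr rfl fun j _ => ?_
  have h := gradGraph_leibniz_der (ν.1.1, ν.2.1) (hx j) (hy (j - ν.1.2))
  linear_combination conj (ZMod.stdAddChar (j * ν.2.2) : ℂ) * h

lemma curvature_tfT {x x₁ x₂ y y₁ y₂ : L2T q}
    (hx : ∀ k, (x k, x₁ k, x₂ k) ∈ gradGraph) (hy : ∀ k, (y k, y₁ k, y₂ k) ∈ gradGraph) :
    ⟪y₁, x₂⟫_ℂ - ⟪y₂, x₁⟫_ℂ = 2 * Real.pi * Complex.I * ⟪y, x⟫_ℂ := by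
  rw [PiLp.inner_apply, PiLp.inner_apply, PiLp.inner_apply, Finset.mul_sum,
    ← Finset.sum_sub_distrib]
  exact Finset.sum_congr rfl fun j _ => gradGraph_curvature (hx j) (hy j)

lemma exists_gradient {φ : 𝓢(ℝ, ℂ)} (hφ : φ ≠ 0) {s : ℝ} (hs : 1 ≤ s) {x : L2T q}
    (hx : ∀ k, Integrable fun z : ℝ × ℝ => ‖stft φ (x k) z‖ * tfWeight s z) :
    ∃ x₁ x₂ : L2T q, ∀ k, (x k, x₁ k, x₂ k) ∈ gradGraph := by
  have h1 : ∀ k, ∃ a b, (x k, a, b) ∈ gradGraph := fun k => by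
    refine exists_gradGraph hφ ((hx k).mono' ?_ (ae_of_all _ fun z => ?_))
    · exact ((continuous_stft φ _).norm.mul (by fun_prop)).aestronglyMeasurable
    · have hb := one_le_base z
      rw [Real.norm_of_nonneg (mul_nonneg (norm_nonneg _) (by linarith))]
      exact mul_le_mul_of_nonneg_left (Real.self_le_rpow_of_one_le hb hs) (norm_nonneg _)
  choose a b hab using h1
  exact ⟨WithLp.toLp 2 a, WithLp.toLp 2 b, hab⟩

end Gradient

/-! ### Integrals of functions with constant periodization -/

section Periodization

/-- The `n`-th translate of a fundamental rectangle. -/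
def latticeCell (a b : ℝ) (n : ℤ × ℤ) : Set (ℝ × ℝ) :=
  Set.Ioc (n.1 • a) ((n.1 + 1) • a) ×ˢ Set.Ioc (n.2 • b) ((n.2 + 1) • b)

lemma measurableSet_latticeCell (a b : ℝ) (n : ℤ × ℤ) : MeasurableSet (latticeCell a b n) :=
  measurableSet_Ioc.prod measurableSet_Ioc

lemma iUnion_latticeCell {a b : ℝ} (ha : 0 < a) (hb : 0 < b) :
    ⋃ n, latticeCell a b n = Set.univ := by
  refine Set.eq_univ_of_forall fun z => ?_
  have h1 : z.1 ∈ ⋃ n : ℤ, Set.Ioc (n • a) ((n + 1) • a) := by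
    rw [iUnion_Ioc_zsmul ha]; trivial
  have h2 : z.2 ∈ ⋃ n : ℤ, Set.Ioc (n • b) ((n + 1) • b) := by
    rw [iUnion_Ioc_zsmul hb]; trivial
  obtain ⟨m, hm⟩ := Set.mem_iUnion.1 h1
  obtain ⟨n, hn⟩ := Set.mem_iUnion.1 h2
  exact Set.mem_iUnion.2 ⟨(m, n), hm, hn⟩

lemma pairwise_disjoint_latticeCell (a b : ℝ) :
    Pairwise fun m n => Disjoint (latticeCell a b m) (latticeCell a b n) := by
  intro m n hmn
  rcases Prod.ext_iff.not.1 hmn |> not_and_or.1 with h | h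
  · exact Set.disjoint_prod.2 (Or.inl (Set.pairwise_disjoint_Ioc_zsmul a h))
  · exact Set.disjoint_prod.2 (Or.inr (Set.pairwise_disjoint_Ioc_zsmul b h))

lemma setIntegral_latticeCell {E : Type*} [NormedAddCommGroup E] [NormedSpace ℝ E] (a b : ℝ)
    (w : ℝ × ℝ → E) (n : ℤ × ℤ) :
    ∫ z in latticeCell a b n, w z = ∫ z in latticeCell a b 0, w (z + (a * n.1, b * n.2)) := by
  have h := (measurePreserving_add_right (volume : Measure (ℝ × ℝ))
    (a * n.1, b * n.2)).setIntegral_preimage_emb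
    (MeasurableEquiv.addRight (a * (n.1 : ℝ), b * (n.2 : ℝ))).measurableEmbedding w
    (latticeCell a b n)
  rw [← h]
  congr 2
  ext z
  simp only [latticeCell, Set.mem_preimage, Set.mem_prod, Set.mem_Ioc, zsmul_eq_mul, Prod.fst_add,
    Prod.snd_add, Prod.fst_zero, Prod.snd_zero]
  push_cast
  constructor <;> rintro ⟨⟨h1, h2⟩, h3, h4⟩ <;> refine ⟨⟨?_, ?_⟩, ?_, ?_⟩ <;> linarith

lemma volume_latticeCell {a b : ℝ} (ha : 0 < a) (hb : 0 < b) :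
    (volume : Measure (ℝ × ℝ)).real (latticeCell a b 0) = a * b := by
  rw [latticeCell, Measure.volume_eq_prod, measureReal_prod_prod]
  simp [ha.le, hb.le]

/-- The integral unfolds into a sum over cells, each translated to the base cell; integrability of
`w` allows summing under the integral. -/
lemma integral_eq_of_hasSum_add {w : ℝ × ℝ → ℂ} (hw : Integrable w) {a b : ℝ} (ha : 0 < a)
    (hb : 0 < b) {C : ℂ} (h : ∀ z, HasSum (fun n : ℤ × ℤ => w (z + (a * n.1, b * n.2))) C) :
    ∫ z, w z = (a * b : ℝ) * C := by
  have h1 : ∀ {E : Type} [NormedAddCommGroup E] [NormedSpace ℝ E] {u : ℝ × ℝ → E},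
      Integrable u → HasSum (fun n : ℤ × ℤ =>
        ∫ z in latticeCell a b 0, u (z + (a * n.1, b * n.2))) (∫ z, u z) := by
    intro E _ _ u hu
    have := hasSum_integral_iUnion (measurableSet_latticeCell a b)
      (pairwise_disjoint_latticeCell a b) (f := u) (μ := volume) hu.integrableOn
    rw [iUnion_latticeCell ha hb, setIntegral_univ] at this
    simpa only [setIntegral_latticeCell a b u] using this
  have h2 := hasSum_integral_of_summable_integral_norm
    (F := fun (n : ℤ × ℤ) (z : ℝ × ℝ) => w (z + (a * n.1, b * n.2)))
    (μ := volume.restrict (latticeCell a b 0))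
    (fun n => (hw.comp_add_right _).integrableOn) (h1 hw.norm).summable
  rw [(h1 hw).unique h2]
  simp only [(h _).tsum_eq]
  rw [setIntegral_const, volume_latticeCell ha hb, Complex.real_smul]

/-- Handles the sign of `α` and the change from `z - ν` to `z + ν` in one reindexing. -/
lemma exists_equiv_int_abs {α : ℝ} (hα : α ≠ 0) : ∃ e : ℤ ≃ ℤ, ∀ n, α * e n = -(|α| * n) := by
  rcases hα.lt_or_gt with h | h
  · exact ⟨Equiv.refl ℤ, fun n => by rw [abs_of_neg h]; simp⟩
  · exact ⟨Equiv.neg ℤ, fun n => by rw [abs_of_pos h]; simp⟩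

/-- A function whose translates along a lattice add up to a constant has integral equal to that
constant times the covolume. -/
lemma integral_eq_of_hasSum_sub {w : ℝ × ℝ → ℂ} (hw : Integrable w) {α β : ℝ} (hα : α ≠ 0)
    (hβ : β ≠ 0) {C : ℂ} (h : ∀ z, HasSum (fun n : ℤ × ℤ => w (z - (α * n.1, β * n.2))) C) :
    ∫ z, w z = (|α * β| : ℝ) * C := by
  obtain ⟨e, he⟩ := exists_equiv_int_abs hα
  obtain ⟨d, hd⟩ := exists_equiv_int_abs hβ
  rw [abs_mul]
  refine integral_eq_of_hasSum_add hw (abs_pos.2 hα) (abs_pos.2 hβ) fun z => ?_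
  refine ((e.prodCongr d).hasSum_iff.2 (h z)).congr_fun fun n => ?_
  simp [he, hd, sub_eq_add_neg]

end Periodization

/-! ### The inner product of dual windows -/

section Covolume

open scoped InnerProductSpace

variable {q : ℕ} [NeZero q] {α β : ℝ} {r t : ℕ}

lemma inner_tfT_single (Z : Phase q) (φ : 𝓢(ℝ, ℂ)) (x : L2T q) :
    ⟪tfT Z (PiLp.single 2 0 (φ.toLp 2 (volume : Measure ℝ))), x⟫_ℂ =
      conj (ZMod.stdAddChar (Z.1.2 * Z.2.2) : ℂ) * stft φ (x Z.1.2) (Z.1.1, Z.2.1) := by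
  rw [inner_tfT, Finset.sum_eq_single Z.1.2]
  · rw [sub_self, PiLp.single_eq_same, stft]
  · intro j _ hj
    rw [PiLp.single_eq_of_ne 2 (sub_ne_zero.2 hj), map_zero, inner_zero_left, mul_zero]
  · simp

/-- The dual expansion of a shifted test window, paired with that window. Each coefficient is a
short-time Fourier transform up to a unimodular phase, and the phases cancel in the product. -/
lemma hasSum_stft_mul_stft (hα : α ≠ 0) (hβ : β ≠ 0) (φ : 𝓢(ℝ, ℂ)) {x y : L2T q}
    (hexp : ∀ f v : L2T q, HasSum (fun ν : lattice q α β r t =>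
      ⟪tfT (ν : Phase q) x, f⟫_ℂ * ⟪v, tfT (ν : Phase q) y⟫_ℂ) ⟪v, f⟫_ℂ) (z : ℝ × ℝ) (l : ZMod q) :
    HasSum (fun n : ℤ × ℤ => conj (stft φ (x (l - n.1 * r)) (z - (α * n.1, β * n.2))) *
      stft φ (y (l - n.1 * r)) (z - (α * n.1, β * n.2)))
      ⟪φ.toLp 2 (volume : Measure ℝ), φ.toLp 2 (volume : Measure ℝ)⟫_ℂ := by
  -- With `φ` in the slot `0` only, shifting by `l` selects the slice `l`; a discrete modulation
  -- would add only a phase, so its parameter is `0`.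
  set F : L2T q := PiLp.single 2 0 (φ.toLp 2 (volume : Measure ℝ)) with hF
  set Z : Phase q := ((z.1, l), (z.2, 0)) with hZ
  have h1 := (latticeEquiv q hα hβ r t).hasSum_iff.2 (hexp (tfT Z F) (tfT Z F))
  have h2 : ⟪tfT Z F, tfT Z F⟫_ℂ =
      ⟪φ.toLp 2 (volume : Measure ℝ), φ.toLp 2 (volume : Measure ℝ)⟫_ℂ := by
    rw [(tfT Z).inner_map_map, inner_self_eq_norm_sq_to_K, inner_self_eq_norm_sq_to_K, hF]
    congr 2
    exact PiLp.norm_single 2 (fun _ : ZMod q => L2R) 0 (φ.toLp 2 (volume : Measure ℝ))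
  rw [h2] at h1
  refine h1.congr_fun fun n => ?_
  have h3 : ∀ a : L2T q, ⟪tfT Z F, tfT (latticePoint q α β r t n : Phase q) a⟫_ℂ =
      conj (ZMod.stdAddChar ((l - n.1 * r) * (0 - n.2 * t) : ZMod q) : ℂ) *
        stft φ (a (l - n.1 * r)) (z - (α * n.1, β * n.2)) *
        cocycle (latticePoint q α β r t n : Phase q) (Z - (latticePoint q α β r t n : Phase q)) :=
            by
    intro a
    rw [← isProjRep_tfT.inner_map_sub, hF, inner_tfT_single]
    rfl
  have h4 := isProjRep_tfT.conj_mul_cocycle (latticePoint q α β r t n : Phase q)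
    (Z - (latticePoint q α β r t n : Phase q))
  have h5 := conj_stdAddChar_mul ((l - n.1 * r) * (0 - n.2 * t) : ZMod q)
  change _ = ⟪tfT (latticePoint q α β r t n : Phase q) x, tfT Z F⟫_ℂ *
    ⟪tfT Z F, tfT (latticePoint q α β r t n : Phase q) y⟫_ℂ
  rw [← inner_conj_symm, h3 x, h3 y]
  simp only [map_mul, Complex.conj_conj]
  linear_combination (-1 : ℂ) * conj (stft φ (x (l - n.1 * r)) (z - (α * n.1, β * n.2))) *
      stft φ (y (l - n.1 * r)) (z - (α * n.1, β * n.2)) * (h5 +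
      conj (ZMod.stdAddChar ((l - n.1 * r) * (0 - n.2 * t) : ZMod q) : ℂ) *
      ZMod.stdAddChar ((l - n.1 * r) * (0 - n.2 * t) : ZMod q) * h4)

lemma integrable_conj_stft_mul (φ : 𝓢(ℝ, ℂ)) (a : L2R) {b : L2R} (hb : Integrable (stft φ b)) :
    Integrable fun z => conj (stft φ a z) * stft φ b z := by
  refine ((integrable_stft_smul_tfL φ hb).const_inner a).congr (ae_of_all _ fun z => ?_)
  dsimp only
  rw [inner_smul_right, stft, stft, inner_conj_symm, mul_comm]

lemma integral_conj_stft_mul (φ : 𝓢(ℝ, ℂ)) (a : L2R) {b : L2R} (hb : Integrable (stft φ b)) :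
    ∫ z, conj (stft φ a z) * stft φ b z =
      ⟪φ.toLp 2 (volume : Measure ℝ), φ.toLp 2 (volume : Measure ℝ)⟫_ℂ * ⟪a, b⟫_ℂ := by
  rw [← inner_smul_right, ← integral_stft_smul_tfL φ hb,
    ← integral_inner (integrable_stft_smul_tfL φ hb)]
  congr 1
  funext z
  rw [inner_smul_right, stft, stft, inner_conj_symm, mul_comm]

/-- Dual Gabor windows have inner product `q|αβ|`. -/
lemma inner_eq_covolume (hα : α ≠ 0) (hβ : β ≠ 0) {φ : 𝓢(ℝ, ℂ)} (hφ : φ ≠ 0) {x y : L2T q}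
    (hy : ∀ k, Integrable (stft φ (y k)))
    (hexp : ∀ f v : L2T q, HasSum (fun ν : lattice q α β r t =>
      ⟪tfT (ν : Phase q) x, f⟫_ℂ * ⟪v, tfT (ν : Phase q) y⟫_ℂ) ⟪v, f⟫_ℂ) :
    ⟪y, x⟫_ℂ = q * (|α * β| : ℝ) := by
  set c := ⟪φ.toLp 2 (volume : Measure ℝ), φ.toLp 2 (volume : Measure ℝ)⟫_ℂ with hc
  have hc0 : c ≠ 0 := inner_self_ne_zero.2 (norm_toLp_ne_zero hφ)
  have h1 := integral_eq_of_hasSum_sub (α := α) (β := β) (C := q * c)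
    (w := fun z => ∑ l, conj (stft φ (x l) z) * stft φ (y l) z)
    (integrable_finsetSum _ fun l _ => integrable_conj_stft_mul φ (x l) (hy l)) hα hβ fun z => by
      -- Each `l` contributes the same constant, hence the factor `q`. For fixed `n`, translation by
      -- `n.1 * r` permutes the residues, so the sum over `l` does not see it.
      have h2 := hasSum_sum fun (l : ZMod q) (_ : l ∈ Finset.univ) =>
        hasSum_stft_mul_stft hα hβ φ hexp z l
      rw [Finset.sum_const, Finset.card_univ, ZMod.card, nsmul_eq_mul] at h2
      refine h2.congr_fun fun n => ?_
      exact ((Equiv.subRight (n.1 * r : ZMod q)).sum_comp fun l =>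
        conj (stft φ (x l) (z - (α * n.1, β * n.2))) *
          stft φ (y l) (z - (α * n.1, β * n.2))).symm
  rw [integral_finsetSum _ fun l _ => integrable_conj_stft_mul φ (x l) (hy l)] at h1
  simp only [integral_conj_stft_mul φ _ (hy _)] at h1
  rw [← Finset.mul_sum, ← PiLp.inner_apply] at h1
  have h3 : ⟪x, y⟫_ℂ = q * (|α * β| : ℝ) := mul_left_cancel₀ hc0 (h1.trans (by ring))
  rw [← inner_conj_symm, h3]
  simp

end Covolume

/-! ### The trace of the commutator and the Chern number -/

section Main

open scoped InnerProductSpace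

variable {q : ℕ}

/-- The additive map `(λ, l, γ, c) ↦ 2πiλ` on a lattice. -/
def timeWeight (L : AddSubgroup (Phase q)) : L →+ ℂ where
  toFun ν := 2 * Real.pi * Complex.I * (ν.1.1.1 : ℂ)
  map_zero' := by simp
  map_add' μ ν := by
    simp only [AddSubgroup.coe_add, Prod.fst_add, Complex.ofReal_add]
    ring

/-- The additive map `(λ, l, γ, c) ↦ 2πiγ` on a lattice. -/
def freqWeight (L : AddSubgroup (Phase q)) : L →+ ℂ where
  toFun ν := 2 * Real.pi * Complex.I * (ν.1.2.1 : ℂ)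
  map_zero' := by simp
  map_add' μ ν := by
    simp only [AddSubgroup.coe_add, Prod.fst_add, Prod.snd_add, Complex.ofReal_add]
    ring

lemma integrable_stft_of_weight {φ : 𝓢(ℝ, ℂ)} {s : ℝ} (hs : 0 ≤ s) {a : L2R}
    (ha : Integrable fun z : ℝ × ℝ => ‖stft φ a z‖ * tfWeight s z) : Integrable (stft φ a) :=
  ha.mono' (continuous_stft φ a).aestronglyMeasurable (ae_of_all _ fun z =>
    le_mul_of_one_le_right (norm_nonneg _) (one_le_tfWeight hs z))

variable [NeZero q]

lemma trace_commutator {φ : 𝓢(ℝ, ℂ)} (hφ : φ ≠ 0) {s : ℝ} (hs : 1 ≤ s)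
    {L : AddSubgroup (Phase q)} {x y : L2T q}
    (hx : ∀ k, Integrable fun z : ℝ × ℝ => ‖stft φ (x k) z‖ * tfWeight s z)
    (hy : ∀ k, Integrable fun z : ℝ × ℝ => ‖stft φ (y k) z‖ * tfWeight s z)
    (D : IsDualPair (latticeCocycle L) (fun ν : L => tfT (ν : Phase q)) x y)
    (hsum : Summable fun ν : L =>
      ‖⟪tfT (ν : Phase q) y, x⟫_ℂ‖ * (1 + |ν.1.1.1| + |ν.1.2.1|) ^ s)
    {p : L → ℂ} (hp : p = fun ν : L => ⟪tfT (ν : Phase q) y, x⟫_ℂ) :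
    trace (twistedConv p
      (twistedConv (deriv1 p) (deriv2 p) - twistedConv (deriv2 p) (deriv1 p))) =
      2 * Real.pi * Complex.I * ⟪y, x⟫_ℂ := by
  subst hp
  obtain ⟨x₁, x₂, hx'⟩ := exists_gradient hφ hs hx
  obtain ⟨y₁, y₂, hy'⟩ := exists_gradient hφ hs hy
  rw [← curvature_tfT hx' hy']
  exact D.tconv_commutator (timeWeight L) (freqWeight L)
    (summable_mul_of_weight hs hsum fun ν => by linarith [abs_nonneg ν.1.2.1])
    (summable_mul_of_weight hs hsum fun ν => by linarith [abs_nonneg ν.1.1.1])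
    (fun ν => leibniz_tfT_pos (ν : Phase q) hx' hy')
    (fun ν => leibniz_tfT_der (ν : Phase q) hx' hy')

end Main

end GaborTorus

end

theorem mainTheorem3 (q : ℕ) [NeZero q] (α β : ℝ) (hα : α ≠ 0) (hβ : β ≠ 0)
    (r t : ℕ) (hr : r < q) (ht : t < q) (hrq : Nat.Coprime r q) (htq : Nat.Coprime t q)
    (φ : 𝓢(ℝ, ℂ)) (hφ : φ ≠ 0) (s : ℝ) (hs : 1 ≤ s)
    (g h : GaborTorus.TimeDomain q → ℂ)
    (hg : GaborTorus.MemM1 φ s g) (hh : GaborTorus.MemM1 φ s h)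
    (hdual : GaborTorus.AreDualGaborFrames φ s (GaborTorus.lattice q α β r t) g h)
    (p : GaborTorus.lattice q α β r t → ℂ)
    (hp : p = GaborTorus.latticeInner (GaborTorus.lattice q α β r t) g h) :
    GaborTorus.MemEll1 s p ∧ GaborTorus.twistedConv p p = p ∧
      GaborTorus.connesChern α β r t p = (q : ℂ) := by
  have hs0 : 0 ≤ s := by linarith
  have hx : ∀ k, Integrable fun z : ℝ × ℝ => ‖GaborTorus.stft φ (GaborTorus.toL2T g hg.memLp k) z‖ *
      GaborTorus.tfWeight s z := fun k => (hg.2 k).integrable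
  have hy : ∀ k, Integrable fun z : ℝ × ℝ => ‖GaborTorus.stft φ (GaborTorus.toL2T h hh.memLp k) z‖ *
      GaborTorus.tfWeight s z := fun k => (hh.2 k).integrable
  have hexp := hdual.expansion hg hh
  have hp' : p = fun ν : GaborTorus.lattice q α β r t =>
      inner ℂ (GaborTorus.tfT (ν : GaborTorus.Phase q) (GaborTorus.toL2T h hh.memLp))
        (GaborTorus.toL2T g hg.memLp) :=
    hp.trans (funext fun ν => GaborTorus.latticeInner_eq _ hg.memLp hh.memLp ν)
  have hsum := GaborTorus.summable_inner_tfT (x := GaborTorus.toL2T g hg.memLp)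
    (y := GaborTorus.toL2T h hh.memLp) (r := r) (t := t) hφ hs0 hα hβ hx hy
  have hsum0 := GaborTorus.summable_of_weight hs0 hsum
  have D : GaborTorus.IsDualPair (GaborTorus.latticeCocycle (GaborTorus.lattice q α β r t))
      (fun ν : GaborTorus.lattice q α β r t => GaborTorus.tfT (ν : GaborTorus.Phase q))
      (GaborTorus.toL2T g hg.memLp) (GaborTorus.toL2T h hh.memLp) :=
    ⟨GaborTorus.isProjRep_lattice _, hexp, hsum0⟩
  refine ⟨?_, ?_, ?_⟩
  · rw [hp']
    exact ⟨hsum0, hsum⟩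
  · rw [hp']
    exact D.tconv_self
  · have hy0 : ∀ k, Integrable (GaborTorus.stft φ (GaborTorus.toL2T h hh.memLp k)) := fun k =>
      GaborTorus.integrable_stft_of_weight hs0 (hy k)
    have hc := GaborTorus.inner_eq_covolume hα hβ hφ hy0 hexp
    -- The trace is `2πi · q|αβ|`, and the normalising factor removes all but `q`.
    rw [GaborTorus.connesChern, GaborTorus.trace_commutator hφ hs hx hy D hsum hp', hc]
    have h1 : ((|α * β| : ℝ) : ℂ) ≠ 0 :=
      Complex.ofReal_ne_zero.2 (abs_ne_zero.2 (mul_ne_zero hα hβ))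
    have h2 : (2 * Real.pi * Complex.I : ℂ) ≠ 0 := Complex.two_pi_I_ne_zero
    field_simp
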